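/- All graphs are finite and simple. The spectral radius $\rho(G)$ of a graph $G$ is the maximum modulus of the eigenvalues of its adjacency matrix. A graph is outerplanar if it can be drawn in the plane without crossings so that every vertex lies on the boundary of the outer (unbounded) face; it is $F$-free if it has no (not necessarily induced) subgraph isomorphic to $F$. Let $\mathrm{spex}_{\mathcal{OP}}(n,F)$ be the maximum of $\rho(G)$ over all $F$-free outerplanar graphs $G$ on $n$ vertices (connected or not); the extremal graphs are those $F$-free outerplanar graphs on $n$ vertices whose spectral radius is equal to $\mathrm{spex}_{\mathcal{OP}}(n,F)$. Let $(t+1)K_2$ be the disjoint union of $t+1$ copies of $K_2$, let $P_k$ be the path on $k$ vertices, and let $\vee$ denote the join of two graphs. Theorem 3. Let $t\ge 1$ and $n$ be integers with $$n\ \ge\ N+\frac32+3\sqrt{N-\frac74},\qquad N=\max\{1.27\times 10^7,\ 6.5025\times 2^{2t+1}\}.$$ Then, up to isomorphism, there is exactly one extremal graph for $\mathrm{spex}_{\mathcal{OP}}(n,(t+1)K_2)$, namely (i) the star $K_{1,n-1}$ if $t=1$; (ii) the graph $K_1\vee\bigl(P_{2t-1}\cup(n-2t)K_1\bigr)$ if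 $t\ge 2$. -/

import Mathlib

open scoped ENNReal

namespace OuterplanarSpex

/-- The Euclidean plane. -/
abbrev Plane : Type := EuclideanSpace ℝ (Fin 2)

/-- `IsPolygonalArc a b S`: the set `S` is a (simple) polygonal arc with the distinct ends `a` and
`b`, i.e. a non-self-intersecting chain of finitely many straight segments leading from `a` to `b`.
Either `S` is a single segment, or it consists of a first segment and of a polygonal arc that
meets this segment exactly in its endpoint. -/
inductive IsPolygonalArc : Plane → Plane → Set Plane → Prop
  | single (a b : Plane) (hab : a ≠ b) : IsPolygonalArc a b (segment ℝ a b)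
  | cons (a b c : Plane) (S : Set Plane) (hab : a ≠ b) (hS : IsPolygonalArc b c S)
      (hmeet : segment ℝ a b ∩ S = {b}) : IsPolygonalArc a c (segment ℝ a b ∪ S)

/-- A crossing-free drawing of `G` in the plane: the vertices are distinct points, each edge is a
polygonal arc joining its ends, an edge contains no vertex other than its ends, and two different
edges meet at most in common ends. (Only the values of `arc` at edges of `G` matter.) -/
structure PlaneDrawing {V : Type*} (G : SimpleGraph V) where
  /-- the point that represents a vertex -/
  point : V → Plane
  /-- the arc that represents an edge -/
  arc : Sym2 V → Set Plane
  point_injective : Function.Injective point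
  isPolygonalArc : ∀ u v : V, G.Adj u v → IsPolygonalArc (point u) (point v) (arc s(u, v))
  mem_of_point_mem_arc : ∀ e ∈ G.edgeSet, ∀ w : V, point w ∈ arc e → w ∈ e
  arc_inter_arc : ∀ e ∈ G.edgeSet, ∀ f ∈ G.edgeSet, e ≠ f → ∀ x ∈ arc e ∩ arc f,
    ∃ w : V, w ∈ e ∧ w ∈ f ∧ x = point w

/-- The point set of a drawing: all its vertices and edges. -/
def PlaneDrawing.support {V : Type*} {G : SimpleGraph V} (D : PlaneDrawing G) : Set Plane :=
  Set.range D.point ∪ ⋃ e ∈ G.edgeSet, D.arc e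

/-- The outer face of a drawing: the points off the drawing whose connected component in the
complement of the drawing is unbounded. -/
def PlaneDrawing.outerFace {V : Type*} {G : SimpleGraph V} (D : PlaneDrawing G) : Set Plane :=
  {x | x ∈ D.supportᶜ ∧ ¬ Bornology.IsBounded (connectedComponentIn D.supportᶜ x)}

/-- A graph is outerplanar if it has a crossing-free drawing in the plane in which every vertex
lies on the boundary of the outer face. -/
def IsOuterplanar {V : Type*} (G : SimpleGraph V) : Prop :=
  ∃ D : PlaneDrawing G, ∀ v : V, D.point v ∈ frontier D.outerFace

open scoped Classical in
/-- The spectral radius of a graph: the maximum modulus of the (complex) eigenvalues of its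
adjacency matrix. -/
noncomputable def rho {V : Type*} [Fintype V] (G : SimpleGraph V) : ℝ≥0∞ :=
  spectralRadius ℂ (G.adjMatrix ℂ)

/-- The `F`-free outerplanar graphs with the vertex set `Fin n` (`F` is not a subgraph, induced
or not). -/
def freeOuterplanar {W : Type*} (n : ℕ) (F : SimpleGraph W) : Set (SimpleGraph (Fin n)) :=
  {G | IsOuterplanar G ∧ F.Free G}

/-- `spex_OP(n, F)`: the maximum spectral radius over all `F`-free outerplanar graphs of
order `n`. -/
noncomputable def spexOP {W : Type*} (n : ℕ) (F : SimpleGraph W) : ℝ≥0∞ :=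
  ⨆ G ∈ freeOuterplanar n F, rho G

/-- `SPEX_OP(n, F)`: the extremal graphs, i.e. the `F`-free outerplanar graphs of order `n` whose
spectral radius is equal to `spex_OP(n, F)`. -/
def extremalOP {W : Type*} (n : ℕ) (F : SimpleGraph W) : Set (SimpleGraph (Fin n)) :=
  {G | G ∈ freeOuterplanar n F ∧ rho G = spexOP n F}

/-- The join `G ∨ H`: the disjoint union of `G` and `H` together with all edges between them. -/
def join {V W : Type*} (G : SimpleGraph V) (H : SimpleGraph W) : SimpleGraph (V ⊕ W) :=
  (G ⊕g H) ⊔ completeBipartiteGraph V W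

/-- The graph `k K₂`: the disjoint union of `k` copies of `K₂`. -/
def copiesK2 (k : ℕ) : SimpleGraph (Fin k × Fin 2) where
  Adj x y := x.1 = y.1 ∧ x.2 ≠ y.2
  symm := ⟨fun _ _ h => ⟨h.1.symm, h.2.symm⟩⟩
  loopless := ⟨fun _ h => h.2 rfl⟩

/-- The star `K_{1,n-1}`. -/
def star (n : ℕ) : SimpleGraph (Fin 1 ⊕ Fin (n - 1)) :=
  completeBipartiteGraph (Fin 1) (Fin (n - 1))

/-- The graph `K₁ ∨ (P_{2t-1} ∪ (n-2t) K₁)`. -/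
def joinPath (n t : ℕ) : SimpleGraph (Fin 1 ⊕ (Fin (2 * t - 1) ⊕ Fin (n - 2 * t))) :=
  join (⊤ : SimpleGraph (Fin 1))
    (SimpleGraph.pathGraph (2 * t - 1) ⊕g (⊥ : SimpleGraph (Fin (n - 2 * t))))

end OuterplanarSpex

/-! Two consequences of outerplanarity suffice. Two vertices never have three common neighbours (no
`K_{2,3}`), and the graph induced on the neighbours of a vertex has no cycle (no wheel); so every
neighbourhood induces a linear forest. Both follow from a theta lemma, proved without the Jordan
curve theorem. Off an arc from `a` to `b` there is a continuous branch of `log((b - x)/(a - x))`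
vanishing at infinity. For two arcs with the same ends the difference of the branches is locally
constant with values in `2πiℤ`, a winding number of the closed curve they form, and it is zero on
the outer face. If each of three arcs lay outside the curve formed by the other two, comparing
arguments near the end `a` would give an identity that is wrong by `π` modulo `2π` (`theta_false`).

On the spectral side, let `l` be the spectral radius of a competitor `G`, at least that of `joinPath
n t`, so `l² ≥ n - 1`. Having no matching of size `t + 1`, `G` has a vertex cover of at most `2t`
vertices, and the codegree bound leaves only `O(t²)` vertices of degree above one. Hence a vertex
`u` of maximal Perron weight has degree at least `l² - 5l/2 - 2`, and each vertex `w` not adjacent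
to `u` has weight below `1/l`. Cutting the edges at all such `w` and joining them to `u` then
increases the quadratic form (`exists_dominating_vertex`). The result is the join of a vertex with a
linear forest `H`, and `H` has no matching of size `t` because `u` has a neighbour to spare. The new
graph need not itself be known to be outerplanar; only these properties of `H` are used.

For such a join with `m` the order of `H` and `d` its degrees, the eigenvalue equation expands to
`l(l² - m) = ∑ d + (∑ d²)/l + ...`. A linear forest with matching number at most `t - 1` has at most
`2t - 2` edges, which settles the first term. For equally many edges, `∑ d²` equals four times the
number of edges minus the number of leaves, so the fewest leaves win, and `H` is one path with
isolated vertices (`join_iso_of_le`). The comparison forces equality throughout, including that `u`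
was already adjacent to every other vertex. The candidate is admissible by a straight-line fan
drawing and a vertex cover of size `t`. -/

namespace OuterplanarSpex

open Set Filter Topology

/-! ### Branches of the logarithm cut along arcs -/

/-- The plane as the complex plane. -/
noncomputable def toComplex : Plane ≃ₗᵢ[ℝ] ℂ := Complex.orthonormalBasisOneI.repr.symm

/-- Near the end `a` of the arc `S`, the function `f` is a branch of the logarithm that is cut along
a segment of `S`, up to a summand that is continuous at `a`. -/
def HasLogGerm (S : Set Plane) (f : Plane → ℂ) (a : Plane) : Prop :=
  ∃ p, p ≠ a ∧ segment ℝ a p ⊆ S ∧ ∃ R : Plane → ℂ, ContinuousAt R a ∧ ∀ x ∉ S,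
    f x = Complex.log ((toComplex p - toComplex x) / (toComplex a - toComplex x)) + R x

/-- `S` is an arc from `a` to `b`, and `f` is, off `S`, the continuous branch of the logarithm of
`(b - x) / (a - x)` that vanishes at infinity. -/
structure LogArc (a b : Plane) (S : Set Plane) (f : Plane → ℂ) : Prop where
  ne : a ≠ b
  closed : IsClosed S
  left_mem : a ∈ S
  right_mem : b ∈ S
  cont : ContinuousOn f Sᶜ
  exp_eq : ∀ x ∉ S, Complex.exp (f x) = (toComplex b - toComplex x) / (toComplex a - toComplex x)
  tendsto_zero : Tendsto f (cocompact Plane) (𝓝 0)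
  preconnected : IsPreconnected (S \ {a, b})
  left_germ : HasLogGerm S f a
  right_germ : HasLogGerm S (-f) b

theorem toComplex_sub_ne_zero {x y : Plane} (h : x ≠ y) : toComplex x - toComplex y ≠ 0 := by
  rw [sub_ne_zero]
  exact fun h' => h (toComplex.injective h')

/-- If the quotient were a real `r ≤ 0`, then `b - x = r (a - x)` would exhibit `x` as a convex
combination of `a` and `b`. So for a single segment the principal logarithm is the required branch.
-/
theorem div_mem_slitPlane {a b x : Plane} (hx : x ∉ segment ℝ a b) :
    (toComplex b - toComplex x) / (toComplex a - toComplex x) ∈ Complex.slitPlane := by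
  have hxa : a ≠ x := fun h => hx (h ▸ left_mem_segment ℝ a b)
  rw [Complex.mem_slitPlane_iff_not_le_zero]
  intro hle
  obtain ⟨r, hr, hre⟩ : ∃ r : ℝ, r ≤ 0 ∧
      (toComplex b - toComplex x) / (toComplex a - toComplex x) = r := by
    rw [Complex.le_def] at hle
    refine ⟨_, hle.1, Complex.ext rfl ?_⟩
    simpa using hle.2
  rw [div_eq_iff (toComplex_sub_ne_zero hxa)] at hre
  have h2 : toComplex (b - x) = toComplex (r • (a - x)) := by
    rw [map_smul, map_sub, map_sub, hre, Complex.real_smul]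
  have h3 := toComplex.injective h2
  apply hx
  have hpos : 0 < 1 - r := by linarith
  refine ⟨-r / (1 - r), 1 / (1 - r), div_nonneg (by linarith) hpos.le, by positivity, ?_, ?_⟩
  · field_simp
    ring
  · have hb : b = x + r • (a - x) := by rw [← h3]; abel
    rw [hb]
    have e1 : (1 / (1 - r)) * (1 - r) = 1 := by field_simp
    have : (-r / (1 - r)) • a + (1 / (1 - r)) • (x + r • (a - x))
        = ((1 / (1 - r)) * (1 - r)) • x := by
      module
    rw [this, e1, one_smul]

theorem preconnected_segment_diff (a b : Plane) : IsPreconnected (segment ℝ a b \ {a, b}) := by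
  by_cases hab : a = b
  · subst hab
    simp [isPreconnected_empty]
  have : segment ℝ a b \ {a, b} = openSegment ℝ a b := by
    ext x
    constructor
    · rintro ⟨hx, hx'⟩
      simp only [mem_insert_iff, mem_singleton_iff, not_or] at hx'
      exact mem_openSegment_of_ne_left_right (Ne.symm hx'.1) (Ne.symm hx'.2) hx
    · intro hx
      refine ⟨openSegment_subset_segment ℝ a b hx, ?_⟩
      simp only [mem_insert_iff, mem_singleton_iff, not_or]
      constructor
      · rintro rfl
        exact hab ((left_mem_openSegment_iff).1 hx)
      · rintro rfl
        exact hab ((right_mem_openSegment_iff).1 hx)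
  rw [this]
  exact (convex_openSegment a b).isPreconnected

theorem tendsto_div_cocompact (a b : Plane) :
    Tendsto (fun x => (toComplex b - toComplex x) / (toComplex a - toComplex x))
      (cocompact Plane) (𝓝 1) := by
  have h1 : Tendsto (fun x => toComplex a - toComplex x) (cocompact Plane) (cocompact ℂ) := by
    have : Tendsto (fun z : ℂ => toComplex a - z) (cocompact ℂ) (cocompact ℂ) :=
      (Homeomorph.subLeft (toComplex a)).isClosedEmbedding.tendsto_cocompact
    exact this.comp toComplex.toHomeomorph.isClosedEmbedding.tendsto_cocompact
  have h2 : Tendsto (fun x => 1 + (toComplex b - toComplex a) * (toComplex a - toComplex x)⁻¹)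
      (cocompact Plane) (𝓝 (1 + (toComplex b - toComplex a) * 0)) :=
    ((tendsto_inv₀_cobounded.comp
      (by simpa [Metric.cobounded_eq_cocompact] using h1)).const_mul _).const_add _
  rw [mul_zero, add_zero] at h2
  refine h2.congr' ?_
  have h3 : ∀ᶠ x in cocompact Plane, x ≠ a := by
    have := (isCompact_singleton (x := a)).compl_mem_cocompact
    filter_upwards [this] with x hx using hx
  filter_upwards [h3] with x hx
  have := toComplex_sub_ne_zero (Ne.symm hx)
  field_simp
  ring

theorem LogArc.single {a b : Plane} (hab : a ≠ b) :
    LogArc a b (segment ℝ a b)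
      (fun x => Complex.log ((toComplex b - toComplex x) / (toComplex a - toComplex x))) where
  ne := hab
  closed := by
    rw [segment_eq_image_lineMap]
    exact (isCompact_Icc.image (by fun_prop)).isClosed
  left_mem := left_mem_segment ℝ a b
  right_mem := right_mem_segment ℝ a b
  cont := by
    refine ContinuousOn.clog (ContinuousOn.div (by fun_prop) (by fun_prop) ?_) ?_
    · intro x hx
      exact toComplex_sub_ne_zero fun h => hx (h ▸ left_mem_segment ℝ a b)
    · intro x hx
      exact div_mem_slitPlane hx
  exp_eq x hx := Complex.exp_log (Complex.slitPlane_ne_zero (div_mem_slitPlane hx))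
  tendsto_zero := by
    have := (tendsto_div_cocompact a b).clog (by simp)
    simpa using this
  preconnected := preconnected_segment_diff a b
  left_germ := ⟨b, hab.symm, Subset.rfl, 0, continuousAt_const, fun x _ => by simp⟩
  right_germ := by
    refine ⟨a, hab, (segment_symm ℝ a b).ge, 0, continuousAt_const, fun x hx => ?_⟩
    have hs := div_mem_slitPlane hx
    simp only [Pi.neg_apply, Pi.zero_apply, add_zero]
    rw [← Complex.log_inv _ (Complex.slitPlane_arg_ne_pi hs), inv_div]

theorem LogArc.reverse {a b : Plane} {S : Set Plane} {f : Plane → ℂ} (h : LogArc a b S f) :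
    LogArc b a S (-f) where
  ne := h.ne.symm
  closed := h.closed
  left_mem := h.right_mem
  right_mem := h.left_mem
  cont := h.cont.neg
  exp_eq x hx := by
    rw [Pi.neg_apply, Complex.exp_neg, h.exp_eq x hx, inv_div]
  tendsto_zero := by
    rw [← neg_zero]
    exact h.tendsto_zero.neg
  preconnected := by rw [pair_comm]; exact h.preconnected
  left_germ := h.right_germ
  right_germ := by rw [neg_neg]; exact h.left_germ

theorem HasLogGerm.mono {S T : Set Plane} {f g h : Plane → ℂ} {a : Plane} (hf : HasLogGerm S f a)
    (hST : S ⊆ T) (hg : ContinuousAt g a) (hh : ∀ x, h x = f x + g x) : HasLogGerm T h a := by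
  obtain ⟨p, hp, hs, R, hR, hfR⟩ := hf
  refine ⟨p, hp, hs.trans hST, R + g, hR.add hg, fun x hx => ?_⟩
  rw [hh, hfR x fun h => hx (hST h), Pi.add_apply]
  ring

theorem LogArc.continuousAt {a b x : Plane} {S : Set Plane} {f : Plane → ℂ} (h : LogArc a b S f)
    (hx : x ∉ S) : ContinuousAt f x :=
  h.cont.continuousAt (h.closed.isOpen_compl.mem_nhds hx)

/-- Used to put an end back onto an arc whose ends were removed, without losing preconnectedness:
the points of the initial segment that are close to `b` avoid the finite set. -/
theorem mem_closure_of_segment {S : Set Plane} {b q : Plane} (F : Set Plane) (hF : F.Finite)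
    (hq : q ≠ b) (hs : segment ℝ b q ⊆ S) : b ∈ closure (S \ F) := by
  have hc : Tendsto (fun r : ℝ => AffineMap.lineMap b q r) (𝓝[>] 0) (𝓝 b) := by
    have : ContinuousAt (fun r : ℝ => AffineMap.lineMap b q r) 0 := by fun_prop
    have h := this.tendsto
    rw [AffineMap.lineMap_apply_zero] at h
    exact h.mono_left nhdsWithin_le_nhds
  refine mem_closure_of_tendsto hc ?_
  have hinj : Function.Injective (fun r : ℝ => AffineMap.lineMap b q r) :=
    AffineMap.lineMap_injective ℝ hq.symm
  have hfin : ((fun r : ℝ => AffineMap.lineMap b q r) ⁻¹' (F \ {b})).Finite :=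
    (hF.subset sdiff_subset).preimage hinj.injOn
  have h0 : (0 : ℝ) ∉ ((fun r : ℝ => AffineMap.lineMap b q r) ⁻¹' (F \ {b})) := by simp
  have h1 : ∀ᶠ r in 𝓝[>] (0 : ℝ), r ∉ ((fun r : ℝ => AffineMap.lineMap b q r) ⁻¹' (F \ {b})) :=
    nhdsWithin_le_nhds (hfin.isClosed.isOpen_compl.mem_nhds h0)
  have h2 : ∀ᶠ r in 𝓝[>] (0 : ℝ), r ∈ Ioc (0 : ℝ) 1 := Ioc_mem_nhdsGT one_pos
  filter_upwards [h1, h2] with r hr1 hr2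
  refine ⟨hs ?_, fun hF' => hr1 ⟨hF', ?_⟩⟩
  · rw [segment_eq_image_lineMap]
    exact ⟨r, ⟨hr2.1.le, hr2.2⟩, rfl⟩
  · intro h
    have : r = 0 := hinj (by simpa using h)
    exact hr2.1.ne' this

/-- The quotients telescope, so the branches add. The end `a` is off `T` and `c` is off `S`, so at
each end the other summand is continuous and is absorbed into the remainder of the germ. -/
theorem LogArc.trans {a b c : Plane} {S T : Set Plane} {f g : Plane → ℂ} (hf : LogArc a b S f)
    (hg : LogArc b c T g) (hST : S ∩ T = {b}) : LogArc a c (S ∪ T) (f + g) := by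
  have haT : a ∉ T := fun h => hf.ne (by simpa using hST.subset ⟨hf.left_mem, h⟩)
  have hcS : c ∉ S := fun h => hg.ne (by simpa using (hST.subset ⟨h, hg.right_mem⟩).symm)
  have hac : a ≠ c := fun h => hcS (h ▸ hf.left_mem)
  refine ⟨hac, hf.closed.union hg.closed, Or.inl hf.left_mem, Or.inr hg.right_mem, ?_, ?_, ?_, ?_,
    ?_, ?_⟩
  · exact (hf.cont.mono (compl_subset_compl.2 subset_union_left)).add
      (hg.cont.mono (compl_subset_compl.2 subset_union_right))
  · intro x hx
    simp only [mem_union, not_or] at hx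
    rw [Pi.add_apply, Complex.exp_add, hf.exp_eq x hx.1, hg.exp_eq x hx.2]
    have h1 := toComplex_sub_ne_zero (x := a) (y := x) fun h => hx.1 (h ▸ hf.left_mem)
    have h2 := toComplex_sub_ne_zero (x := b) (y := x) fun h => hx.1 (h ▸ hf.right_mem)
    field_simp
  · rw [← add_zero (0 : ℂ)]
    exact hf.tendsto_zero.add hg.tendsto_zero
  · obtain ⟨q, hq, hqs, -⟩ := hf.right_germ
    obtain ⟨p, hp, hps, -⟩ := hg.left_germ
    have h1 : IsPreconnected (insert b (S \ {a, b})) :=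
      hf.preconnected.subset_closure (subset_insert _ _)
        (insert_subset (mem_closure_of_segment _ (by simp) hq hqs) subset_closure)
    have h2 : IsPreconnected (insert b (T \ {b, c})) :=
      hg.preconnected.subset_closure (subset_insert _ _)
        (insert_subset (mem_closure_of_segment _ (by simp) hp hps) subset_closure)
    have h3 := h1.union b (mem_insert _ _) (mem_insert _ _) h2
    convert! h3 using 1
    ext x
    simp only [Set.mem_sdiff, mem_union, mem_insert_iff, mem_singleton_iff, not_or]
    have hbS := hf.right_mem
    have hba := hf.ne
    have hbc := hg.ne
    constructor
    · tauto
    · rintro ((rfl | h) | (rfl | h))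
      · exact ⟨Or.inl hbS, hba.symm, hbc⟩
      · exact ⟨Or.inl h.1, h.2.1, fun hc => hcS (hc ▸ h.1)⟩
      · exact ⟨Or.inl hbS, hba.symm, hbc⟩
      · exact ⟨Or.inr h.1, fun ha => haT (ha ▸ h.1), h.2.2⟩
  · exact hf.left_germ.mono subset_union_left (hg.continuousAt haT) fun x => rfl
  · refine hg.right_germ.mono subset_union_right (hf.continuousAt hcS).neg fun x => ?_
    simp only [Pi.neg_apply, Pi.add_apply]
    ring

theorem IsPolygonalArc.exists_logArc {a b : Plane} {S : Set Plane} (h : IsPolygonalArc a b S) :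
    ∃ f, LogArc a b S f := by
  induction h with
  | single a b hab => exact ⟨_, LogArc.single hab⟩
  | cons a b c S hab _ hmeet ih =>
    obtain ⟨g, hg⟩ := ih
    exact ⟨_, (LogArc.single hab).trans hg hmeet⟩

/-- The values lie in the countable, hence totally disconnected, set `2πiℤ`. -/
theorem eq_of_preconnected_of_exp_eq_one {h : Plane → ℂ} {S : Set Plane} (hS : IsPreconnected S)
    (hc : ContinuousOn h S) (he : ∀ x ∈ S, Complex.exp (h x) = 1) {x y : Plane} (hx : x ∈ S)
    (hy : y ∈ S) : h x = h y := by
  have hcount : (h '' S).Countable := by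
    refine (countable_range fun n : ℤ => (n : ℂ) * (2 * Real.pi * Complex.I)).mono ?_
    rintro _ ⟨z, hz, rfl⟩
    obtain ⟨n, hn⟩ := Complex.exp_eq_one_iff.1 (he z hz)
    exact ⟨n, hn.symm⟩
  exact hcount.isTotallyDisconnected _ Subset.rfl (hS.image h hc) (mem_image_of_mem h hx)
    (mem_image_of_mem h hy)

/-! ### Two arcs with the same ends -/

section Pair
variable {a b : Plane} {S T : Set Plane} {f g : Plane → ℂ}

theorem LogArc.exp_sub_eq_one (hf : LogArc a b S f) (hg : LogArc a b T g) {x : Plane}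
    (hx : x ∉ S ∪ T) : Complex.exp (f x - g x) = 1 := by
  simp only [mem_union, not_or] at hx
  rw [Complex.exp_sub, hf.exp_eq x hx.1, hg.exp_eq x hx.2, div_self]
  exact div_ne_zero (toComplex_sub_ne_zero fun h => hx.1 (h ▸ hf.right_mem))
    (toComplex_sub_ne_zero fun h => hx.1 (h ▸ hf.left_mem))

/-- The difference `f - g` plays the role of `2πi` times the winding number of the closed curve `S ∪
T`; `f x = g x` will be the meaning of "`x` lies outside of the curve". -/
theorem LogArc.sub_eq_sub (hf : LogArc a b S f) (hg : LogArc a b T g) {K : Set Plane}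
    (hK : IsPreconnected K) (hKST : Disjoint K (S ∪ T)) {x y : Plane} (hx : x ∈ K) (hy : y ∈ K) :
    f x - g x = f y - g y := by
  have hsub : K ⊆ (S ∪ T)ᶜ := hKST.subset_compl_right
  refine eq_of_preconnected_of_exp_eq_one (h := fun x => f x - g x) hK ?_
    (fun z hz => hf.exp_sub_eq_one hg (hsub hz)) hx hy
  exact (hf.cont.mono (hsub.trans (compl_subset_compl.2 subset_union_left))).sub
    (hg.cont.mono (hsub.trans (compl_subset_compl.2 subset_union_right)))

/-- The points off `X` that lie in an unbounded component of the complement of `X`. -/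
def unboundedFace (X : Set Plane) : Set Plane :=
  {x | x ∈ Xᶜ ∧ ¬ Bornology.IsBounded (connectedComponentIn Xᶜ x)}

/-- The component is unbounded, so it contains points where both branches are small; a multiple of
`2πi` of norm less than `1` is zero. -/
theorem LogArc.eq_of_mem_unboundedFace (hf : LogArc a b S f) (hg : LogArc a b T g) {X : Set Plane}
    (hS : S ⊆ X) (hT : T ⊆ X) {y : Plane} (hy : y ∈ unboundedFace X) : f y = g y := by
  have hcc : connectedComponentIn Xᶜ y ⊆ Xᶜ := connectedComponentIn_subset _ _
  have hyK : y ∈ connectedComponentIn Xᶜ y := mem_connectedComponentIn hy.1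
  have hz := hf.tendsto_zero.sub hg.tendsto_zero
  rw [sub_zero] at hz
  have hev : ∀ᶠ x in cocompact Plane, ‖f x - g x‖ < 1 := by
    filter_upwards [hz.eventually (Metric.ball_mem_nhds 0 one_pos)] with x hx
    simpa using hx
  rw [← Metric.cobounded_eq_cocompact] at hev
  have hex : ∃ x ∈ connectedComponentIn Xᶜ y, ‖f x - g x‖ < 1 := by
    by_contra! hcon
    apply hy.2
    rw [Bornology.isBounded_def]
    filter_upwards [hev] with x hx hx'
    exact absurd hx (not_lt.2 (hcon x hx'))
  obtain ⟨x, hx, hx1⟩ := hex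
  have hdisj : Disjoint (connectedComponentIn Xᶜ y) (S ∪ T) :=
    disjoint_left.2 fun z hz hz' => hcc hz (union_subset hS hT hz')
  have heq := hf.sub_eq_sub hg isPreconnected_connectedComponentIn hdisj hyK hx
  have h1 := hf.exp_sub_eq_one hg (disjoint_left.1 hdisj hx)
  obtain ⟨n, hn⟩ := Complex.exp_eq_one_iff.1 h1
  rw [hn, norm_mul] at hx1
  have h2 : ‖(2 * Real.pi * Complex.I : ℂ)‖ = 2 * Real.pi := by
    simp [abs_of_pos Real.pi_pos]
  rw [h2, Complex.norm_intCast] at hx1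
  have hn0 : n = 0 := by
    by_contra hne
    have : (1 : ℝ) ≤ |(n : ℝ)| := by exact_mod_cast Int.one_le_abs hne
    nlinarith [Real.pi_gt_three]
  rw [hn, hn0] at heq
  simpa [sub_eq_zero] using heq

/-- A small disc around `c` avoids both arcs and meets the unbounded face. This is where the
position of the vertices on the outer boundary enters. -/
theorem LogArc.eq_of_mem_frontier (hf : LogArc a b S f) (hg : LogArc a b T g) {X : Set Plane}
    (hS : S ⊆ X) (hT : T ⊆ X) {c : Plane} (hc : c ∈ frontier (unboundedFace X))
    (hcS : c ∉ S ∪ T) : f c = g c := by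
  have hopen : IsOpen (S ∪ T)ᶜ := (hf.closed.union hg.closed).isOpen_compl
  obtain ⟨ε, hε, hball⟩ := Metric.isOpen_iff.1 hopen c hcS
  obtain ⟨y, hy, hyc⟩ := Metric.mem_closure_iff.1 (frontier_subset_closure hc) ε hε
  have hdisj : Disjoint (Metric.ball c ε) (S ∪ T) := disjoint_left.2 fun z hz => hball hz
  have := hf.sub_eq_sub hg (convex_ball c ε).isPreconnected hdisj (Metric.mem_ball_self hε)
    (Metric.mem_ball'.2 hyc)
  rw [hf.eq_of_mem_unboundedFace hg hS hT hy, sub_self] at this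
  exact sub_eq_zero.1 this

/-- If two log arcs agree at one interior point of a third arc that is disjoint from them, they
agree at all of its interior points. -/
theorem LogArc.eq_on_arc (hf : LogArc a b S f) (hg : LogArc a b T g) {c d : Plane} {P : Set Plane}
    {h : Plane → ℂ} (hP : LogArc c d P h) (hPS : Disjoint (P \ {c, d}) (S ∪ T)) {x y : Plane}
    (hx : x ∈ P \ {c, d}) (hxe : f x = g x) (hy : y ∈ P \ {c, d}) : f y = g y := by
  have := hf.sub_eq_sub hg hP.preconnected hPS hx hy
  rw [hxe, sub_self] at this
  exact sub_eq_zero.1 this.symm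

end Pair

/-! ### Angles at a common end, and the theta lemma -/

theorem arg_neg_div_swap {z w : ℂ} (h : -z / w ∈ Complex.slitPlane) :
    Complex.arg (-w / z) = - Complex.arg (-z / w) := by
  have : -w / z = (-z / w)⁻¹ := by rw [inv_div, div_neg, neg_div]
  rw [this, Complex.arg_inv, if_neg (Complex.slitPlane_arg_ne_pi h)]

/-- The product of `-d₁/d₂` and `-d₂/d₃` is the negative of `-d₁/d₃`, so modulo `2π` the two sides
differ by `π`. -/
theorem arg_neg_div_ne {d₁ d₂ d₃ : ℂ} (h₁ : d₁ ≠ 0) (h₂ : d₂ ≠ 0) (h₃ : d₃ ≠ 0) :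
    Complex.arg (-d₁ / d₃) ≠ Complex.arg (-d₁ / d₂) + Complex.arg (-d₂ / d₃) := by
  intro h
  have h' := congrArg (fun r : ℝ => (r : Real.Angle)) h
  simp only [Real.Angle.coe_add] at h'
  rw [← Complex.arg_mul_coe_angle (by simp [h₁, h₂]) (by simp [h₂, h₃])] at h'
  have e : -d₁ / d₂ * (-d₂ / d₃) = -(-d₁ / d₃) := by field_simp
  rw [e, Complex.arg_neg_coe_angle (by simp [h₁, h₃])] at h'
  exact Real.Angle.pi_ne_zero (left_eq_add.1 h')

section Germ

variable {a p₁ p₂ p₃ : Plane}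

/-- Two segments that start in `a` and meet only in `a` (and perhaps in `b`) have different
directions. -/
theorem neg_div_mem_slitPlane {b : Plane} (h₁ : p₁ ≠ a) (h₂ : p₂ ≠ a)
    (h : segment ℝ a p₁ ∩ segment ℝ a p₂ ⊆ {a, b}) :
    -(toComplex (p₂ - a)) / toComplex (p₁ - a) ∈ Complex.slitPlane := by
  rw [Complex.mem_slitPlane_iff_not_le_zero]
  intro hle
  have hd1 : toComplex (p₁ - a) ≠ 0 := by
    rw [map_sub]; exact toComplex_sub_ne_zero h₁
  obtain ⟨r, hr, hre⟩ : ∃ r : ℝ, r ≤ 0 ∧ -(toComplex (p₂ - a)) / toComplex (p₁ - a) = r := by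
    rw [Complex.le_def] at hle
    refine ⟨_, hle.1, Complex.ext rfl ?_⟩
    simpa using hle.2
  rw [div_eq_iff hd1] at hre
  have h3 : p₂ - a = (-r) • (p₁ - a) := by
    apply toComplex.injective
    rw [map_smul, Complex.real_smul]
    push_cast
    linear_combination -hre
  have hr0 : r ≠ 0 := by
    rintro rfl
    rw [neg_zero, zero_smul] at h3
    exact h₂ (sub_eq_zero.1 h3)
  have hrneg : 0 < -r := by
    have := lt_of_le_of_ne hr hr0
    linarith
  -- If the directions agreed, the segments would share a whole initial piece; two different points
  -- of it would both have to be `b`.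
  have key : ∀ s : ℝ, 0 < s → s ≤ 1 → s ≤ 1 / (-r) →
      (a + (s * (-r)) • (p₁ - a)) ∈ ({a, b} : Set Plane) := by
    intro s hs0 hs1 hs2
    apply h
    constructor
    · rw [segment_eq_image']
      refine ⟨s * (-r), ⟨by positivity, ?_⟩, rfl⟩
      rw [le_div_iff₀ hrneg] at hs2
      exact hs2
    · rw [segment_eq_image']
      refine ⟨s, ⟨hs0.le, hs1⟩, ?_⟩
      simp only
      rw [h3, smul_smul]
  have hne : ∀ s : ℝ, 0 < s → a + (s * (-r)) • (p₁ - a) ≠ a := by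
    intro s hs hcon
    have : (s * (-r)) • (p₁ - a) = 0 := by simpa using hcon
    rcases smul_eq_zero.1 this with h' | h'
    · have : 0 < s * (-r) := by positivity
      linarith
    · exact h₁ (sub_eq_zero.1 h')
  set m := min 1 (1 / (-r)) with hm
  have hm0 : 0 < m := by positivity
  have hb : ∀ s : ℝ, 0 < s → s ≤ m → a + (s * (-r)) • (p₁ - a) = b := by
    intro s hs hsm
    exact (key s hs (hsm.trans (min_le_left _ _)) (hsm.trans (min_le_right _ _))).resolve_left
      (hne s hs)
  have e := (hb m hm0 le_rfl).trans (hb (m / 2) (by positivity) (by linarith)).symm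
  have e2 : (m / 2 * (-r)) • (p₁ - a) = 0 := by
    have h5 : (m * (-r)) • (p₁ - a) = (m / 2 * (-r)) • (p₁ - a) := add_left_cancel e
    have h6 : (m * (-r)) • (p₁ - a) = (m / 2 * (-r)) • (p₁ - a) + (m / 2 * (-r)) • (p₁ - a) := by
      module
    rw [h6] at h5
    exact left_eq_add.1 h5.symm
  exact hne (m / 2) (by positivity) (by rw [e2, add_zero])

/-- The imaginary part of a logarithmic branch at `a`, in the direction of another arc. -/
theorem tendsto_im_germ {R : Plane → ℂ} (hR : ContinuousAt R a)
    (hs : -(toComplex (p₂ - a)) / toComplex (p₁ - a) ∈ Complex.slitPlane) (h₁ : p₁ ≠ a) :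
    Tendsto (fun ε : ℝ => (Complex.log ((toComplex p₂ - toComplex (a + ε • (p₁ - a))) /
      (toComplex a - toComplex (a + ε • (p₁ - a)))) + R (a + ε • (p₁ - a))).im) (𝓝[>] 0)
      (𝓝 (Complex.arg (-(toComplex (p₂ - a)) / toComplex (p₁ - a)) + (R a).im)) := by
  have hd1 : toComplex (p₁ - a) ≠ 0 := by
    rw [map_sub]; exact toComplex_sub_ne_zero h₁
  have hcx : ContinuousAt (fun ε : ℝ => a + ε • (p₁ - a)) 0 := by fun_prop
  have hR' : Tendsto (fun ε : ℝ => (R (a + ε • (p₁ - a))).im) (𝓝[>] 0) (𝓝 (R a).im) := by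
    have h1 : ContinuousAt (fun ε : ℝ => R (a + ε • (p₁ - a))) 0 :=
      ContinuousAt.comp (f := fun ε : ℝ => a + ε • (p₁ - a)) (by simpa using hR) hcx
    have h2 := (Complex.continuous_im.continuousAt.comp h1).tendsto
    simp only [Function.comp_def, zero_smul, add_zero] at h2
    exact h2.mono_left nhdsWithin_le_nhds
  have harg : Tendsto (fun ε : ℝ => Complex.arg
      (-(toComplex (p₂ - a) - ε * toComplex (p₁ - a)) / toComplex (p₁ - a))) (𝓝[>] 0)
      (𝓝 (Complex.arg (-(toComplex (p₂ - a)) / toComplex (p₁ - a)))) := by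
    have h1 : ContinuousAt (fun ε : ℝ =>
      -(toComplex (p₂ - a) - ε * toComplex (p₁ - a)) / toComplex (p₁ - a)) 0 := by
      fun_prop (disch := exact hd1)
    have h2 : ContinuousAt Complex.arg ((fun ε : ℝ =>
      -(toComplex (p₂ - a) - ε * toComplex (p₁ - a)) / toComplex (p₁ - a)) 0) := by
      apply Complex.continuousAt_arg
      simpa using hs
    have h3 := (ContinuousAt.comp (f := fun ε : ℝ =>
      -(toComplex (p₂ - a) - ε * toComplex (p₁ - a)) / toComplex (p₁ - a)) h2 h1).tendsto
    simp only [Function.comp_def, Complex.ofReal_zero, zero_mul, sub_zero] at h3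
    exact h3.mono_left nhdsWithin_le_nhds
  refine (harg.add hR').congr' ?_
  filter_upwards [self_mem_nhdsWithin] with ε hε
  have hε' : (0 : ℝ) < ε := hε
  rw [Complex.add_im, Complex.log_im]
  congr 1
  have hεc : (ε : ℂ) ≠ 0 := by exact_mod_cast hε'.ne'
  -- The denominator is `-ε (p₁ - a)`; the positive factor `ε` does not affect the argument.
  rw [← Complex.arg_real_mul (_ / (toComplex a - _)) hε']
  congr 1
  simp only [map_add, map_smul, Complex.real_smul]
  have : toComplex a - (toComplex a + ε * toComplex (p₁ - a)) = -(ε * toComplex (p₁ - a)) := by ring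
  rw [this, map_sub toComplex p₂ a]
  field_simp
  ring

end Germ

/-- The theta lemma: three arcs from `a` to `b` that meet only in their ends cannot all lie outside
of the closed curves formed by the other two. -/
theorem theta_false {a b : Plane} {P₁ P₂ P₃ : Set Plane} {f₁ f₂ f₃ : Plane → ℂ}
    (h₁ : LogArc a b P₁ f₁) (h₂ : LogArc a b P₂ f₂) (h₃ : LogArc a b P₃ f₃)
    (h₁₂ : P₁ ∩ P₂ ⊆ {a, b}) (h₁₃ : P₁ ∩ P₃ ⊆ {a, b}) (h₂₃ : P₂ ∩ P₃ ⊆ {a, b})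
    (e₁ : ∀ x ∈ P₁ \ {a, b}, f₂ x = f₃ x) (e₂ : ∀ x ∈ P₂ \ {a, b}, f₁ x = f₃ x)
    (e₃ : ∀ x ∈ P₃ \ {a, b}, f₁ x = f₂ x) : False := by
  obtain ⟨p₁, hp₁, hs₁, R₁, hR₁, hf₁⟩ := h₁.left_germ
  obtain ⟨p₂, hp₂, hs₂, R₂, hR₂, hf₂⟩ := h₂.left_germ
  obtain ⟨p₃, hp₃, hs₃, R₃, hR₃, hf₃⟩ := h₃.left_germ
  have hab := h₁.ne
  -- Walk to `a` along the initial segment of one arc, where the branches of the other two agree,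
  -- and compare the limits of their imaginary parts.
  have main : ∀ {p q r : Plane} {P Q R : Set Plane} {g k A B : Plane → ℂ}, p ≠ a →
      segment ℝ a p ⊆ P →
      -(toComplex (q - a)) / toComplex (p - a) ∈ Complex.slitPlane →
      -(toComplex (r - a)) / toComplex (p - a) ∈ Complex.slitPlane →
      P ∩ Q ⊆ {a, b} → P ∩ R ⊆ {a, b} → ContinuousAt A a → ContinuousAt B a →
      (∀ x ∉ Q, g x = Complex.log ((toComplex q - toComplex x) /
        (toComplex a - toComplex x)) + A x) →
      (∀ x ∉ R, k x = Complex.log ((toComplex r - toComplex x) /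
        (toComplex a - toComplex x)) + B x) →
      (∀ x ∈ P \ {a, b}, g x = k x) →
      Complex.arg (-(toComplex (q - a)) / toComplex (p - a)) + (A a).im =
        Complex.arg (-(toComplex (r - a)) / toComplex (p - a)) + (B a).im := by
    intro p q r P Q R g k A B hp hsP hq hr hPQ hPR hA hB hg hk hgk
    have t1 := tendsto_im_germ hA hq hp
    have t2 := tendsto_im_germ hB hr hp
    refine tendsto_nhds_unique_of_eventuallyEq t1 t2 ?_
    have hnb : ∀ᶠ ε in 𝓝[>] (0 : ℝ), a + ε • (p - a) ≠ b := by
      have hc : ContinuousAt (fun ε : ℝ => a + ε • (p - a)) 0 := by fun_prop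
      have := hc.eventually_ne (y := b) (by simpa using hab)
      exact nhdsWithin_le_nhds this
    filter_upwards [Ioc_mem_nhdsGT one_pos, hnb] with ε hε hεb
    have hx : a + ε • (p - a) ∈ P := by
      apply hsP
      rw [segment_eq_image']
      exact ⟨ε, ⟨hε.1.le, hε.2⟩, rfl⟩
    have hxa : a + ε • (p - a) ≠ a := by
      intro hcon
      have : ε • (p - a) = 0 := by simpa using hcon
      rcases smul_eq_zero.1 this with h' | h'
      · exact hε.1.ne' h'
      · exact hp (sub_eq_zero.1 h')
    have hxx : a + ε • (p - a) ∉ ({a, b} : Set Plane) := by simp [hxa, hεb]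
    rw [← hg _ fun h => hxx (hPQ ⟨hx, h⟩), ← hk _ fun h => hxx (hPR ⟨hx, h⟩), hgk _ ⟨hx, hxx⟩]
  have h₂₁ : P₂ ∩ P₁ ⊆ {a, b} := inter_comm P₁ P₂ ▸ h₁₂
  have h₃₁ : P₃ ∩ P₁ ⊆ {a, b} := inter_comm P₁ P₃ ▸ h₁₃
  have h₃₂ : P₃ ∩ P₂ ⊆ {a, b} := inter_comm P₂ P₃ ▸ h₂₃
  have s₂₁ := neg_div_mem_slitPlane hp₁ hp₂ ((inter_subset_inter hs₁ hs₂).trans h₁₂)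
  have s₃₁ := neg_div_mem_slitPlane hp₁ hp₃ ((inter_subset_inter hs₁ hs₃).trans h₁₃)
  have s₃₂ := neg_div_mem_slitPlane hp₂ hp₃ ((inter_subset_inter hs₂ hs₃).trans h₂₃)
  have s₁₂ := neg_div_mem_slitPlane hp₂ hp₁ ((inter_subset_inter hs₂ hs₁).trans h₂₁)
  have s₁₃ := neg_div_mem_slitPlane hp₃ hp₁ ((inter_subset_inter hs₃ hs₁).trans h₃₁)
  have s₂₃ := neg_div_mem_slitPlane hp₃ hp₂ ((inter_subset_inter hs₃ hs₂).trans h₃₂)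
  have E1 := main hp₁ hs₁ s₂₁ s₃₁ h₁₂ h₁₃ hR₂ hR₃ hf₂ hf₃ e₁
  have E2 := main hp₂ hs₂ s₁₂ s₃₂ h₂₁ h₂₃ hR₁ hR₃ hf₁ hf₃ e₂
  have E3 := main hp₃ hs₃ s₁₃ s₂₃ h₃₁ h₃₂ hR₁ hR₂ hf₁ hf₂ e₃
  rw [arg_neg_div_swap s₁₂, arg_neg_div_swap s₁₃] at E1
  rw [arg_neg_div_swap s₂₃] at E2
  have hz : ∀ {p : Plane}, p ≠ a → toComplex (p - a) ≠ 0 := fun h => by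
    rw [map_sub]; exact toComplex_sub_ne_zero h
  -- In `E1 + E3 - E2` the values of the remainders at `a` cancel, leaving twice the forbidden
  -- identity.
  exact arg_neg_div_ne (hz hp₁) (hz hp₂) (hz hp₃) (by linarith)

/-- Lets an equality of branches at the end `a` be carried along the interior of the arc. -/
theorem LogArc.preconnected_insert_left {a b : Plane} {S : Set Plane} {f : Plane → ℂ}
    (h : LogArc a b S f) : IsPreconnected (insert a (S \ {a, b})) := by
  obtain ⟨q, hq, hqs, -⟩ := h.left_germ
  exact h.preconnected.subset_closure (subset_insert _ _)
    (insert_subset (mem_closure_of_segment _ (by simp) hq hqs) subset_closure)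

/-- A drawing of `K₄` cannot have all four vertices on the boundary of the unbounded face. -/
theorem k4_false {X : Set Plane} {a b c d : Plane} {ca ad cb bd cd ab : Set Plane}
    {fca fad fcb fbd fcd fab : Plane → ℂ}
    (hca : LogArc c a ca fca) (had : LogArc a d ad fad) (hcb : LogArc c b cb fcb)
    (hbd : LogArc b d bd fbd) (hcd : LogArc c d cd fcd) (hab : LogArc a b ab fab)
    (Xca : ca ⊆ X) (Xad : ad ⊆ X) (Xcb : cb ⊆ X) (Xbd : bd ⊆ X) (Xcd : cd ⊆ X) (Xab : ab ⊆ X)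
    (Fa : a ∈ frontier (unboundedFace X)) (Fb : b ∈ frontier (unboundedFace X))
    (Fc : c ∈ frontier (unboundedFace X)) (Fd : d ∈ frontier (unboundedFace X))
    (i₁ : ca ∩ ad = {a}) (i₂ : cb ∩ bd = {b}) (i₃ : ca ∩ cb = {c}) (i₄ : ad ∩ bd = {d})
    (i₅ : ca ∩ bd = ∅) (i₆ : ad ∩ cb = ∅) (i₇ : ab ∩ cd = ∅)
    (i₈ : ab ∩ ca = {a}) (i₉ : ab ∩ ad = {a}) (i₁₀ : ab ∩ cb = {b}) (i₁₁ : ab ∩ bd = {b}) :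
    False := by
  have hne := hab.ne
  have m1 : ∀ x ∈ ca, x ∈ ad → x = a := fun x h h' => by simpa using i₁.subset ⟨h, h'⟩
  have m2 : ∀ x ∈ cb, x ∈ bd → x = b := fun x h h' => by simpa using i₂.subset ⟨h, h'⟩
  have m3 : ∀ x ∈ ca, x ∈ cb → x = c := fun x h h' => by simpa using i₃.subset ⟨h, h'⟩
  have m4 : ∀ x ∈ ad, x ∈ bd → x = d := fun x h h' => by simpa using i₄.subset ⟨h, h'⟩
  have m5 : ∀ x ∈ ca, x ∉ bd := fun x h h' => i₅.subset ⟨h, h'⟩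
  have m6 : ∀ x ∈ ad, x ∉ cb := fun x h h' => i₆.subset ⟨h, h'⟩
  have m7 : ∀ x ∈ ab, x ∉ cd := fun x h h' => i₇.subset ⟨h, h'⟩
  have m8 : ∀ x ∈ ab, x ∈ ca → x = a := fun x h h' => by simpa using i₈.subset ⟨h, h'⟩
  have m9 : ∀ x ∈ ab, x ∈ ad → x = a := fun x h h' => by simpa using i₉.subset ⟨h, h'⟩
  have m10 : ∀ x ∈ ab, x ∈ cb → x = b := fun x h h' => by simpa using i₁₀.subset ⟨h, h'⟩
  have m11 : ∀ x ∈ ab, x ∈ bd → x = b := fun x h h' => by simpa using i₁₁.subset ⟨h, h'⟩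
  have P1 := hca.trans had i₁
  have P2 := hcb.trans hbd i₂
  -- The arc `ab` may have no interior vertex on the outer boundary, so its position is read off
  -- from its ends, with `c` and `d` as poles: starting in `a` the branch along `c b d` agrees with
  -- that of `cd`, starting in `b` the branch along `c a d` does.
  have hcd_on : ∀ x ∈ ab \ {a, b}, (fca + fad) x = (fcb + fbd) x := by
    intro x hx
    have hd1 : Disjoint (insert a (ab \ {a, b})) ((cb ∪ bd) ∪ cd) := by
      rw [disjoint_left]
      rintro y hy hy'
      have hyab : y ∈ ab ∧ y ≠ b := by
        rcases hy with rfl | hy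
        · exact ⟨hab.left_mem, hne⟩
        · exact ⟨hy.1, fun h => hy.2 (Or.inr h)⟩
      rcases hy' with (h | h) | h
      · exact hyab.2 (m10 y hyab.1 h)
      · exact hyab.2 (m11 y hyab.1 h)
      · exact m7 y hyab.1 h
    have hd2 : Disjoint (insert b (ab \ {b, a})) ((ca ∪ ad) ∪ cd) := by
      rw [disjoint_left]
      rintro y hy hy'
      have hyab : y ∈ ab ∧ y ≠ a := by
        rcases hy with rfl | hy
        · exact ⟨hab.right_mem, hne.symm⟩
        · exact ⟨hy.1, fun h => hy.2 (Or.inr h)⟩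
      rcases hy' with (h | h) | h
      · exact hyab.2 (m8 y hyab.1 h)
      · exact hyab.2 (m9 y hyab.1 h)
      · exact m7 y hyab.1 h
    have q1 := P2.eq_of_mem_frontier hcd (union_subset Xcb Xbd) Xcd Fa
      (disjoint_left.1 hd1 (mem_insert _ _))
    have q2 := P1.eq_of_mem_frontier hcd (union_subset Xca Xad) Xcd Fb
      (disjoint_left.1 hd2 (mem_insert _ _))
    have r1 := P2.sub_eq_sub hcd hab.preconnected_insert_left hd1 (mem_insert _ _)
      (mem_insert_of_mem _ hx)
    have r2 := P1.sub_eq_sub hcd hab.reverse.preconnected_insert_left hd2 (mem_insert _ _)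
      (mem_insert_of_mem _ (by rwa [pair_comm]))
    rw [q1, sub_self] at r1
    rw [q2, sub_self] at r2
    rw [sub_eq_zero.1 r1.symm, sub_eq_zero.1 r2.symm]
  -- Now the poles are `a` and `b`: the theta consists of `a c b`, `a d b` and `ab`. The equality
  -- just found on `ab` is the same relation, rearranged.
  have Q1 := hca.reverse.trans hcb i₃
  have Q2 := had.trans hbd.reverse i₄
  have j12 : (ca ∪ cb) ∩ (ad ∪ bd) ⊆ {a, b} := by
    rintro x ⟨h | h, h' | h'⟩
    · exact Or.inl (m1 x h h')
    · exact absurd h' (m5 x h)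
    · exact absurd h (m6 x h')
    · exact Or.inr (m2 x h h')
  have j13 : (ca ∪ cb) ∩ ab ⊆ {a, b} := by
    rintro x ⟨h | h, h'⟩
    · exact Or.inl (m8 x h' h)
    · exact Or.inr (m10 x h' h)
  have j23 : (ad ∪ bd) ∩ ab ⊆ {a, b} := by
    rintro x ⟨h | h, h'⟩
    · exact Or.inl (m9 x h' h)
    · exact Or.inr (m11 x h' h)
  have hc : c ∈ (ca ∪ cb) \ {a, b} :=
    ⟨Or.inl hca.left_mem, by simp [hca.ne, hcb.ne]⟩
  have hd : d ∈ (ad ∪ bd) \ {a, b} :=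
    ⟨Or.inl had.right_mem, by simp [had.ne.symm, hbd.ne.symm]⟩
  have d1 : Disjoint ((ca ∪ cb) \ {a, b}) ((ad ∪ bd) ∪ ab) := by
    rw [disjoint_left]
    rintro x hx (h | h)
    · exact hx.2 (j12 ⟨hx.1, h⟩)
    · exact hx.2 (j13 ⟨hx.1, h⟩)
  have d2 : Disjoint ((ad ∪ bd) \ {a, b}) ((ca ∪ cb) ∪ ab) := by
    rw [disjoint_left]
    rintro x hx (h | h)
    · exact hx.2 (j12 ⟨h, hx.1⟩)
    · exact hx.2 (j23 ⟨hx.1, h⟩)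
  refine theta_false Q1 Q2 hab j12 j13 j23 (fun x hx => ?_) (fun x hx => ?_) (fun x hx => ?_)
  · exact Q2.eq_on_arc hab Q1 d1 hc (Q2.eq_of_mem_frontier hab (union_subset Xad Xbd) Xab Fc
      (disjoint_left.1 d1 hc)) hx
  · exact Q1.eq_on_arc hab Q2 d2 hd (Q1.eq_of_mem_frontier hab (union_subset Xca Xcb) Xab Fd
      (disjoint_left.1 d2 hd)) hx
  · have := hcd_on x hx
    simp only [Pi.add_apply, Pi.neg_apply] at this ⊢
    linear_combination -this

/-! ### Configurations excluded from outerplanar drawings -/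

namespace PlaneDrawing

variable {V : Type*} {G : SimpleGraph V} (D : PlaneDrawing G)

theorem exists_logArc {u v : V} (h : G.Adj u v) :
    ∃ f, LogArc (D.point u) (D.point v) (D.arc s(u, v)) f :=
  (D.isPolygonalArc u v h).exists_logArc

theorem arc_subset_support {e : Sym2 V} (he : e ∈ G.edgeSet) : D.arc e ⊆ D.support :=
  subset_union_of_subset_right (subset_biUnion_of_mem (u := fun e => D.arc e) he) _

theorem arc_inter_subset {e f : Sym2 V} (he : e ∈ G.edgeSet) (hf : f ∈ G.edgeSet) (hef : e ≠ f)
    {T : Set Plane} (hT : ∀ w, w ∈ e → w ∈ f → D.point w ∈ T) : D.arc e ∩ D.arc f ⊆ T := by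
  intro x hx
  obtain ⟨w, hwe, hwf, rfl⟩ := D.arc_inter_arc e he f hf hef x hx
  exact hT w hwe hwf

theorem arc_inter_eq {u v w : V} (huv : G.Adj u v) (hvw : G.Adj v w) (huw : u ≠ w) :
    D.arc s(u, v) ∩ D.arc s(v, w) = {D.point v} := by
  apply Subset.antisymm
  · refine D.arc_inter_subset huv hvw ?_ fun z hz hz' => ?_
    · simp [huw, huv.ne]
    · simp only [Sym2.mem_iff] at hz hz'
      rcases hz with rfl | rfl
      · rcases hz' with rfl | rfl
        · exact absurd rfl huv.ne
        · exact absurd rfl huw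
      · rfl
  · obtain ⟨f, hf⟩ := D.exists_logArc huv
    obtain ⟨g, hg⟩ := D.exists_logArc hvw
    exact singleton_subset_iff.2 ⟨hf.right_mem, hg.left_mem⟩

theorem arc_inter_eq_empty {u v w z : V} (huv : G.Adj u v) (hwz : G.Adj w z) (h₁ : u ≠ w)
    (h₂ : u ≠ z) (h₃ : v ≠ w) (h₄ : v ≠ z) : D.arc s(u, v) ∩ D.arc s(w, z) = ∅ := by
  rw [← subset_empty_iff]
  refine D.arc_inter_subset huv hwz ?_ fun y hy hy' => ?_
  · simp [h₁, h₂]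
  · simp only [Sym2.mem_iff] at hy hy'
    rcases hy with rfl | rfl <;> rcases hy' with rfl | rfl <;> contradiction

/-- The point set of a walk in a drawing. -/
def walkArc {v w : V} (p : G.Walk v w) : Set Plane := ⋃ e ∈ {e | e ∈ p.edges}, D.arc e

theorem walkArc_subset_support {v w : V} (p : G.Walk v w) : D.walkArc p ⊆ D.support :=
  iUnion₂_subset fun _ he => D.arc_subset_support (p.edges_subset_edgeSet he)

theorem exists_logArc_walk {v w : V} (p : G.Walk v w) (hp : p.IsPath) (hvw : v ≠ w) :
    ∃ f, LogArc (D.point v) (D.point w) (D.walkArc p) f := by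
  induction p with
  | nil => exact absurd rfl hvw
  | @cons u v w h p ih =>
    rw [SimpleGraph.Walk.cons_isPath_iff] at hp
    obtain ⟨f, hf⟩ := D.exists_logArc h
    have hw : D.walkArc (SimpleGraph.Walk.cons h p) = D.arc s(u, v) ∪ D.walkArc p := by
      simp [walkArc, SimpleGraph.Walk.edges_cons, iUnion_or, iUnion_union_distrib]
    rw [hw]
    by_cases hv : v = w
    · subst hv
      have hpn : p = SimpleGraph.Walk.nil := (SimpleGraph.Walk.isPath_iff_nil.1 hp.1).eq_nil
      subst hpn
      refine ⟨f, ?_⟩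
      simpa [walkArc] using hf
    · obtain ⟨g, hg⟩ := ih hp.1 hv
      refine ⟨_, hf.trans hg (Subset.antisymm ?_ (singleton_subset_iff.2
        ⟨hf.right_mem, hg.left_mem⟩))⟩
      rintro x ⟨hx, hx'⟩
      obtain ⟨e, he, hxe⟩ := mem_iUnion₂.1 hx'
      have hue : u ∉ e := fun hu => hp.2 (p.mem_support_of_mem_edges he hu)
      refine D.arc_inter_subset h (p.edges_subset_edgeSet he) ?_ ?_ ⟨hx, hxe⟩
      · rintro rfl
        simp at hue
      · intro z hz hze
        rcases Sym2.mem_iff.1 hz with rfl | rfl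
        · exact absurd hze hue
        · rfl

/-- The paths from `a` to `b` through the `cᵢ` form a theta, and each has its middle vertex on the
outer boundary, hence lies outside the curve of the other two. -/
theorem false_of_k23 (hD : ∀ v, D.point v ∈ frontier D.outerFace) {a b c₁ c₂ c₃ : V} (hab : a ≠ b)
    (h₁₂ : c₁ ≠ c₂) (h₁₃ : c₁ ≠ c₃) (h₂₃ : c₂ ≠ c₃) (ha₁ : G.Adj a c₁) (ha₂ : G.Adj a c₂)
    (ha₃ : G.Adj a c₃) (hb₁ : G.Adj c₁ b) (hb₂ : G.Adj c₂ b) (hb₃ : G.Adj c₃ b) : False := by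
  have build : ∀ {c : V}, G.Adj a c → G.Adj c b →
      ∃ f, LogArc (D.point a) (D.point b) (D.arc s(a, c) ∪ D.arc s(c, b)) f := by
    intro c hac hcb
    obtain ⟨f, hf⟩ := D.exists_logArc hac
    obtain ⟨g, hg⟩ := D.exists_logArc hcb
    exact ⟨_, hf.trans hg (D.arc_inter_eq hac hcb hab)⟩
  have inter : ∀ {c d : V}, c ≠ d → G.Adj a c → G.Adj c b → G.Adj a d → G.Adj d b →
      (D.arc s(a, c) ∪ D.arc s(c, b)) ∩ (D.arc s(a, d) ∪ D.arc s(d, b)) ⊆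
        {D.point a, D.point b} := by
    intro c d hcd hac hcb had hdb
    rw [union_inter_distrib_right, inter_union_distrib_left, inter_union_distrib_left]
    refine union_subset (union_subset ?_ ?_) (union_subset ?_ ?_)
    · rw [Sym2.eq_swap, D.arc_inter_eq hac.symm had hcd]
      simp
    · rw [D.arc_inter_eq_empty hac hdb had.ne hab hcd hcb.ne]
      simp
    · rw [D.arc_inter_eq_empty hcb had hac.ne.symm hcd hab.symm hdb.ne.symm]
      simp
    · rw [Sym2.eq_swap (a := d), D.arc_inter_eq hcb hdb.symm hcd]
      simp
  have sub : ∀ {c : V}, G.Adj a c → G.Adj c b → D.arc s(a, c) ∪ D.arc s(c, b) ⊆ D.support :=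
    fun hac hcb => union_subset (D.arc_subset_support hac) (D.arc_subset_support hcb)
  have main : ∀ {c d e : V} {f g h : Plane → ℂ}, c ≠ d → c ≠ e → G.Adj a c → G.Adj c b →
      G.Adj a d → G.Adj d b → G.Adj a e → G.Adj e b →
      LogArc (D.point a) (D.point b) (D.arc s(a, c) ∪ D.arc s(c, b)) f →
      LogArc (D.point a) (D.point b) (D.arc s(a, d) ∪ D.arc s(d, b)) g →
      LogArc (D.point a) (D.point b) (D.arc s(a, e) ∪ D.arc s(e, b)) h →
      ∀ x ∈ (D.arc s(a, c) ∪ D.arc s(c, b)) \ {D.point a, D.point b}, g x = h x := by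
    intro c d e f g h hcd hce hac hcb had hdb hae heb hf hg hh x hx
    have dis : Disjoint ((D.arc s(a, c) ∪ D.arc s(c, b)) \ {D.point a, D.point b})
        ((D.arc s(a, d) ∪ D.arc s(d, b)) ∪ (D.arc s(a, e) ∪ D.arc s(e, b))) := by
      rw [disjoint_left]
      rintro y hy (h' | h')
      · exact hy.2 (inter hcd hac hcb had hdb ⟨hy.1, h'⟩)
      · exact hy.2 (inter hce hac hcb hae heb ⟨hy.1, h'⟩)
    have hc : D.point c ∈ (D.arc s(a, c) ∪ D.arc s(c, b)) \ {D.point a, D.point b} := by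
      obtain ⟨k, hk⟩ := D.exists_logArc hac
      refine ⟨Or.inl hk.right_mem, ?_⟩
      simp [D.point_injective.eq_iff, hac.ne.symm, hcb.ne]
    exact hg.eq_on_arc hh hf dis hc (hg.eq_of_mem_frontier hh (sub had hdb) (sub hae heb) (hD c)
      (disjoint_left.1 dis hc)) hx
  obtain ⟨f₁, hf₁⟩ := build ha₁ hb₁
  obtain ⟨f₂, hf₂⟩ := build ha₂ hb₂
  obtain ⟨f₃, hf₃⟩ := build ha₃ hb₃
  exact theta_false hf₁ hf₂ hf₃ (inter h₁₂ ha₁ hb₁ ha₂ hb₂) (inter h₁₃ ha₁ hb₁ ha₃ hb₃)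
    (inter h₂₃ ha₂ hb₂ ha₃ hb₃) (main h₁₂ h₁₃ ha₁ hb₁ ha₂ hb₂ ha₃ hb₃ hf₁ hf₂ hf₃)
    (main h₁₂.symm h₂₃ ha₂ hb₂ ha₁ hb₁ ha₃ hb₃ hf₂ hf₁ hf₃)
    (main h₁₃.symm h₂₃.symm ha₃ hb₃ ha₁ hb₁ ha₂ hb₂ hf₃ hf₁ hf₂)

/-- A subdivided `K₄` on `c₁`, `c₂`, `c₃`, `u` in which only the side between `c₁` and `c₃` is
subdivided. In `k4_false` the hub and `c₂` play the roles of `b` and `a`, so the path `p` is the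
side opposite to the spoke `c₂ u`. -/
theorem false_of_wheel (hD : ∀ v, D.point v ∈ frontier D.outerFace) {u c₁ c₂ c₃ : V}
    (h₁₂ : G.Adj c₁ c₂) (h₂₃ : G.Adj c₂ c₃) (h₁₃ : c₁ ≠ c₃) (p : G.Walk c₃ c₁) (hp : p.IsPath)
    (hp₂ : c₂ ∉ p.support) (hpu : u ∉ p.support) (hu₁ : G.Adj u c₁) (hu₂ : G.Adj u c₂)
    (hu₃ : G.Adj u c₃) : False := by
  obtain ⟨fca, hca⟩ := D.exists_logArc h₁₂
  obtain ⟨fad, had⟩ := D.exists_logArc h₂₃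
  obtain ⟨fcb, hcb⟩ := D.exists_logArc hu₁.symm
  obtain ⟨fbd, hbd⟩ := D.exists_logArc hu₃
  obtain ⟨fab, hab⟩ := D.exists_logArc hu₂.symm
  obtain ⟨fcd, hcd⟩ := D.exists_logArc_walk p hp h₁₃.symm
  refine k4_false hca had hcb hbd hcd.reverse hab (D.arc_subset_support h₁₂)
    (D.arc_subset_support h₂₃) (D.arc_subset_support hu₁.symm) (D.arc_subset_support hu₃)
    (D.walkArc_subset_support p) (D.arc_subset_support hu₂.symm) (hD _) (hD _) (hD _) (hD _)
    (D.arc_inter_eq h₁₂ h₂₃ h₁₃) (D.arc_inter_eq hu₁.symm hu₃ h₁₃) ?_ ?_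
    (D.arc_inter_eq_empty h₁₂ hu₃ hu₁.ne.symm h₁₃ hu₂.ne.symm h₂₃.ne)
    (D.arc_inter_eq_empty h₂₃ hu₁.symm h₁₂.ne.symm hu₂.ne.symm h₁₃.symm hu₃.ne.symm) ?_ ?_ ?_ ?_ ?_
  · rw [Sym2.eq_swap, D.arc_inter_eq h₁₂.symm hu₁.symm hu₂.ne.symm]
  · rw [Sym2.eq_swap (a := u), D.arc_inter_eq h₂₃ hu₃.symm hu₂.ne.symm]
  · rw [← subset_empty_iff]
    rintro x ⟨hx, hx'⟩
    obtain ⟨e, he, hxe⟩ := mem_iUnion₂.1 hx'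
    have hz : ∀ z, z ∈ s(c₂, u) → z ∉ e := by
      intro z hz hze
      have := p.mem_support_of_mem_edges he hze
      rcases Sym2.mem_iff.1 hz with rfl | rfl <;> contradiction
    refine D.arc_inter_subset hu₂.symm (p.edges_subset_edgeSet he) ?_ ?_ ⟨hx, hxe⟩
    · rintro rfl
      exact hz c₂ (by simp) (by simp)
    · intro z hz1 hz2
      exact absurd hz2 (hz z hz1)
  · rw [Sym2.eq_swap (a := c₂), Sym2.eq_swap (a := c₁), D.arc_inter_eq hu₂ h₁₂.symm hu₁.ne]
  · rw [Sym2.eq_swap (a := c₂) (b := u), D.arc_inter_eq hu₂ h₂₃ hu₃.ne]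
  · rw [Sym2.eq_swap (a := c₁), D.arc_inter_eq hu₂.symm hu₁ h₁₂.ne.symm]
  · rw [D.arc_inter_eq hu₂.symm hu₃ h₂₃.ne]

end PlaneDrawing

/-- A cycle of `H` splits into its first two edges and a path back; together with `u` this is the
excluded wheel. -/
theorem IsOuterplanar.isAcyclic {V W : Type*} {G : SimpleGraph V} (hG : IsOuterplanar G)
    {H : SimpleGraph W} (φ : H →g G) (hφ : Function.Injective φ) {u : V} (hu : ∀ w, φ w ≠ u)
    (hadj : ∀ a b, H.Adj a b → G.Adj u (φ a)) : H.IsAcyclic := by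
  obtain ⟨D, hD⟩ := hG
  intro v c hc
  cases c with
  | nil => exact SimpleGraph.Walk.not_isCycle_nil hc
  | @cons _ v₂ _ h₁ q =>
    cases q with
    | nil => exact H.irrefl h₁
    | @cons _ v₃ _ h₂ p =>
      have h3 := hc.three_le_length
      have hpath := (SimpleGraph.Walk.cons_isCycle_iff _ _).1 hc
      have hp := (SimpleGraph.Walk.cons_isPath_iff _ _).1 hpath.1
      have hne : v ≠ v₃ := by
        rintro rfl
        have := (SimpleGraph.Walk.isPath_iff_nil.1 hp.1).eq_nil
        subst this
        simp at h3
      refine D.false_of_wheel hD (u := u) (φ.map_adj h₁) (φ.map_adj h₂) (hφ.ne hne) (p.map φ)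
        ((SimpleGraph.Walk.isPath_map_iff_of_injective hφ).2 hp.1) ?_ ?_ (hadj _ _ h₁) (hadj _ _ h₂)
        (hadj _ _ h₂.symm)
      · rw [SimpleGraph.Walk.support_map, List.mem_map]
        rintro ⟨z, hz, hz'⟩
        exact hp.2 (hφ hz' ▸ hz)
      · rw [SimpleGraph.Walk.support_map, List.mem_map]
        rintro ⟨z, hz, hz'⟩
        exact hu z hz'

/-! ### Straight-line drawings of fans -/

section Fan

variable {W : Type*} (k : W → ℕ)

/-- The points of the drawing of a fan: the centre is the origin, the other vertices lie on the line
of height `1`. -/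
noncomputable def fanPoint : Fin 1 ⊕ W → Plane
  | Sum.inl _ => !₂[0, 0]
  | Sum.inr w => !₂[(k w : ℝ), 1]

/-- The segment that represents an edge of a fan. -/
noncomputable def fanArc : Sym2 (Fin 1 ⊕ W) → Set Plane :=
  Sym2.lift ⟨fun a b => segment ℝ (fanPoint k a) (fanPoint k b), fun _ _ => segment_symm ℝ _ _⟩

theorem fanArc_spoke {w : W} {x : Plane} (hx : x ∈ fanArc k s(Sum.inl 0, Sum.inr w)) :
    x 0 = x 1 * k w ∧ 0 ≤ x 1 ∧ x 1 ≤ 1 := by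
  obtain ⟨a, b, ha, hb, hab, rfl⟩ := hx
  simp only [fanPoint, PiLp.add_apply, PiLp.smul_apply, smul_eq_mul]
  simp
  constructor <;> linarith

theorem fanArc_rim {v w : W} (h : k v + 1 = k w) {x : Plane}
    (hx : x ∈ fanArc k s(Sum.inr v, Sum.inr w)) : x 1 = 1 ∧ (k v : ℝ) ≤ x 0 ∧ x 0 ≤ k v + 1 := by
  obtain ⟨a, b, ha, hb, hab, rfl⟩ := hx
  have hw : (k w : ℝ) = k v + 1 := by exact_mod_cast h.symm
  simp only [fanPoint, PiLp.add_apply, PiLp.smul_apply, smul_eq_mul]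
  simp only [hw]
  simp
  refine ⟨hab, ?_, ?_⟩
  · have : a * (k v : ℝ) + b * (k v + 1) = (a + b) * k v + b := by ring
    rw [this, hab]; linarith
  · have : a * (k v : ℝ) + b * (k v + 1) = (a + b) * k v + b := by ring
    rw [this, hab]; linarith

theorem plane_ext {x y : Plane} (h₀ : x 0 = y 0) (h₁ : x 1 = y 1) : x = y := by
  ext i
  fin_cases i <;> assumption

variable {k} (hk : Function.Injective k) {H : SimpleGraph W}
  (hH : ∀ a b, H.Adj a b → k a + 1 = k b ∨ k b + 1 = k a)
include hk

theorem fanPoint_injective : Function.Injective (fanPoint k) := by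
  rintro (a | a) (b | b) h
  · rw [Subsingleton.elim a b]
  · have := congrArg (fun x : Plane => x 1) h
    simp [fanPoint] at this
  · have := congrArg (fun x : Plane => x 1) h
    simp [fanPoint] at this
  · have := congrArg (fun x : Plane => x 0) h
    simp only [fanPoint] at this
    simp at this
    rw [hk this]

omit hk
include hH

theorem join_edge_cases {e : Sym2 (Fin 1 ⊕ W)}
    (he : e ∈ (join (⊤ : SimpleGraph (Fin 1)) H).edgeSet) :
    (∃ w, e = s(Sum.inl 0, Sum.inr w)) ∨ ∃ v w, k v + 1 = k w ∧ e = s(Sum.inr v, Sum.inr w) := by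
  induction e using Sym2.ind with
  | _ x y =>
    rw [SimpleGraph.mem_edgeSet] at he
    rcases x with x | x <;> rcases y with y | y
    · rw [Subsingleton.elim x y] at he
      exact absurd rfl he.ne
    · left
      exact ⟨y, by rw [Subsingleton.elim x 0]⟩
    · left
      exact ⟨x, by rw [Subsingleton.elim y 0, Sym2.eq_swap]⟩
    · right
      have hadj : H.Adj x y := by simpa [join] using he
      rcases hH x y hadj with h | h
      · exact ⟨x, y, h, rfl⟩
      · exact ⟨y, x, h, Sym2.eq_swap⟩

include hk

/-- The straight-line drawing of the join of a vertex and a linear forest. -/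
noncomputable def fanDrawing : PlaneDrawing (join (⊤ : SimpleGraph (Fin 1)) H) where
  point := fanPoint k
  arc := fanArc k
  point_injective := fanPoint_injective hk
  isPolygonalArc u v h := IsPolygonalArc.single _ _ ((fanPoint_injective hk).ne h.ne)
  mem_of_point_mem_arc := by
    intro e he z hz
    rcases join_edge_cases hH he with ⟨w, rfl⟩ | ⟨v, w, hvw, rfl⟩
    · obtain ⟨h0, -, -⟩ := fanArc_spoke k hz
      rcases z with z | z
      · rw [Subsingleton.elim z 0]
        simp
      · simp [fanPoint] at h0
        simp [hk h0]
    · obtain ⟨h0, h1, h2⟩ := fanArc_rim k hvw hz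
      rcases z with z | z
      · simp [fanPoint] at h0
      · simp [fanPoint] at h1 h2
        have h2' : k z ≤ k v + 1 := by exact_mod_cast h2
        rcases Nat.le_iff_lt_or_eq.1 h1 with h | h
        · have : k z = k w := by omega
          simp [hk this]
        · simp [hk h]
  arc_inter_arc := by
    have spoke_rim : ∀ (u v w : W) (x : Plane), k v + 1 = k w →
        x ∈ fanArc k s(Sum.inl 0, Sum.inr u) → x ∈ fanArc k s(Sum.inr v, Sum.inr w) →
        ∃ z : Fin 1 ⊕ W, z ∈ s(Sum.inl 0, Sum.inr u) ∧ z ∈ s(Sum.inr v, Sum.inr w) ∧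
          x = fanPoint k z := by
      intro u v w x hvw hx hx'
      obtain ⟨a0, -, -⟩ := fanArc_spoke k hx
      obtain ⟨b0, b1, b2⟩ := fanArc_rim k hvw hx'
      rw [b0, one_mul] at a0
      rw [a0] at b1 b2
      have b1' : k v ≤ k u := by exact_mod_cast b1
      have b2' : k u ≤ k v + 1 := by
        rw [← Nat.cast_le (α := ℝ), Nat.cast_add, Nat.cast_one]
        exact b2
      refine ⟨Sum.inr u, by simp, ?_, plane_ext (by simpa [fanPoint] using a0)
        (by simpa [fanPoint] using b0)⟩
      rcases Nat.le_iff_lt_or_eq.1 b1' with h | h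
      · have : k u = k w := by omega
        simp [hk this]
      · simp [hk h]
    have rim_rim : ∀ (v w v' w' : W) (x : Plane), k v + 1 = k w → k v' + 1 = k w' → k v < k v' →
        x ∈ fanArc k s(Sum.inr v, Sum.inr w) → x ∈ fanArc k s(Sum.inr v', Sum.inr w') →
        w = v' ∧ x = fanPoint k (Sum.inr w) := by
      intro v w v' w' x h h' hlt hx hx'
      obtain ⟨a0, a1, a2⟩ := fanArc_rim k h hx
      obtain ⟨b0, b1, b2⟩ := fanArc_rim k h' hx'
      have e1 : (k v' : ℝ) ≤ k v + 1 := b1.trans a2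
      have e2 : k v' ≤ k v + 1 := by exact_mod_cast e1
      have e3 : k w = k v' := by omega
      refine ⟨hk e3, plane_ext ?_ (by simpa [fanPoint] using a0)⟩
      have e4 : (k w : ℝ) = k v + 1 := by exact_mod_cast h.symm
      have e5 : (k w : ℝ) = k v' := by exact_mod_cast e3
      simp [fanPoint]
      linarith
    intro e he f hf hef x hx
    rcases join_edge_cases hH he with ⟨w, rfl⟩ | ⟨v, w, hvw, rfl⟩ <;>
      rcases join_edge_cases hH hf with ⟨w', rfl⟩ | ⟨v', w', hvw', rfl⟩
    · obtain ⟨a0, -, -⟩ := fanArc_spoke k hx.1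
      obtain ⟨b0, -, -⟩ := fanArc_spoke k hx.2
      have hne : (k w : ℝ) - k w' ≠ 0 := by
        rw [sub_ne_zero]
        intro h
        have hw : w = w' := hk (by exact_mod_cast h)
        rw [hw] at hef
        exact hef rfl
      have hz : x 1 * ((k w : ℝ) - k w') = 0 := by linarith
      have hz' : x 1 = 0 := (mul_eq_zero.1 hz).resolve_right hne
      refine ⟨Sum.inl 0, by simp, by simp, plane_ext ?_ ?_⟩
      · rw [a0, hz']; simp [fanPoint]
      · rw [hz']; simp [fanPoint]
    · exact spoke_rim _ _ _ _ hvw' hx.1 hx.2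
    · obtain ⟨z, h1, h2, h3⟩ := spoke_rim _ _ _ _ hvw hx.2 hx.1
      exact ⟨z, h2, h1, h3⟩
    · rcases lt_trichotomy (k v) (k v') with h | h | h
      · obtain ⟨rfl, h2⟩ := rim_rim _ _ _ _ _ hvw hvw' h hx.1 hx.2
        exact ⟨Sum.inr w, by simp, by simp, h2⟩
      · have hw : w = w' := hk (by omega)
        have hv : v = v' := hk h
        rw [hv, hw] at hef
        exact absurd rfl hef
      · obtain ⟨rfl, h2⟩ := rim_rim _ _ _ _ _ hvw' hvw h hx.2 hx.1
        exact ⟨Sum.inr w', by simp, by simp, h2⟩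

theorem fanDrawing_support {x : Plane} (hx : x ∈ (fanDrawing hk hH).support) :
    0 ≤ x 1 ∧ x 1 ≤ 1 := by
  rcases hx with ⟨z, rfl⟩ | hx
  · rcases z with z | z <;> simp [fanDrawing, fanPoint]
  · obtain ⟨e, he, hxe⟩ := mem_iUnion₂.1 hx
    rcases join_edge_cases hH he with ⟨w, rfl⟩ | ⟨v, w, hvw, rfl⟩
    · exact (fanArc_spoke k hxe).2
    · rw [(fanArc_rim k hvw hxe).1]
      norm_num

/-- The drawing lies in the strip `0 ≤ x 1 ≤ 1`, so both complementary half-planes are unbounded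
connected sets that avoid it. -/
theorem fanDrawing_outerFace {x : Plane} (hx : x 1 < 0 ∨ 1 < x 1) :
    x ∈ (fanDrawing hk hH).outerFace := by
  have key : ∀ K : Set Plane, Convex ℝ K → (∀ y ∈ K, y 1 < 0 ∨ 1 < y 1) → x ∈ K →
      (∀ r : ℝ, ∃ y ∈ K, r < ‖y‖) → x ∈ (fanDrawing hk hH).outerFace := by
    intro K hK hKs hxK hKr
    have hsub : K ⊆ (fanDrawing hk hH).supportᶜ := by
      intro y hy hys
      have := fanDrawing_support hk hH hys
      rcases hKs y hy with h | h <;> linarith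
    refine ⟨hsub hxK, fun hb => ?_⟩
    have hb' := hb.subset (hK.isPreconnected.subset_connectedComponentIn hxK hsub)
    obtain ⟨r, hr⟩ := hb'.exists_norm_le
    obtain ⟨y, hy, hry⟩ := hKr r
    exact absurd (hr y hy) (not_le.2 hry)
  have hlin : IsLinearMap ℝ fun y : Plane => y 1 := ⟨fun _ _ => rfl, fun _ _ => rfl⟩
  rcases hx with h | h
  · refine key {y | y 1 < 0} (convex_halfSpace_lt hlin 0) (fun y hy => Or.inl hy) h fun r => ?_
    refine ⟨!₂[0, -(|r| + 1)], ?_, ?_⟩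
    · have := abs_nonneg r
      simp
      linarith
    · have h1 : |-(|r| + 1)| ≤ ‖(!₂[0, -(|r| + 1)] : Plane)‖ :=
        PiLp.norm_apply_le (!₂[0, -(|r| + 1)] : Plane) 1
      rw [abs_neg] at h1
      have h2 := le_abs_self r
      have h4 := le_abs_self (|r| + 1)
      linarith
  · refine key {y | 1 < y 1} (convex_halfSpace_gt hlin 1) (fun y hy => Or.inr hy) h fun r => ?_
    refine ⟨!₂[0, |r| + 2], ?_, ?_⟩
    · have := abs_nonneg r
      simp
      linarith
    · have h1 : |(|r| + 2)| ≤ ‖(!₂[0, |r| + 2] : Plane)‖ :=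
        PiLp.norm_apply_le (!₂[0, |r| + 2] : Plane) 1
      have h2 := le_abs_self r
      have h4 := le_abs_self (|r| + 2)
      linarith

/-- The centre is approached vertically from below the strip, every other vertex from above. -/
theorem isOuterplanar_join : IsOuterplanar (join (⊤ : SimpleGraph (Fin 1)) H) := by
  refine ⟨fanDrawing hk hH, fun z => ?_⟩
  have hnot : (fanDrawing hk hH).point z ∉ (fanDrawing hk hH).outerFace :=
    fun h => h.1 (Or.inl ⟨z, rfl⟩)
  suffices h : (fanDrawing hk hH).point z ∈ closure (fanDrawing hk hH).outerFace from
    ⟨h, fun h' => hnot (interior_subset h')⟩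
  have hlim : ∀ s : ℝ, Tendsto (fun ε : ℝ => fanPoint k z + ε • (!₂[0, s] : Plane)) (𝓝[>] 0)
      (𝓝 (fanPoint k z)) := by
    intro s
    have : ContinuousAt (fun ε : ℝ => fanPoint k z + ε • (!₂[0, s] : Plane)) 0 := by fun_prop
    have h := this.tendsto
    simp only [zero_smul, add_zero] at h
    exact h.mono_left nhdsWithin_le_nhds
  rcases z with z | z
  · refine mem_closure_of_tendsto (hlim (-1)) ?_
    filter_upwards [self_mem_nhdsWithin] with ε hε
    have hε' : (0 : ℝ) < ε := hε
    apply fanDrawing_outerFace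
    left
    simpa [fanPoint] using hε'
  · refine mem_closure_of_tendsto (hlim 1) ?_
    filter_upwards [self_mem_nhdsWithin] with ε hε
    have hε' : (0 : ℝ) < ε := hε
    apply fanDrawing_outerFace
    right
    simpa [fanPoint] using hε'

end Fan

theorem IsOuterplanar.of_iso {V W : Type*} {G : SimpleGraph V} {G' : SimpleGraph W} (e : G ≃g G')
    (h : IsOuterplanar G') : IsOuterplanar G := by
  obtain ⟨D, hD⟩ := h
  have hedge : ∀ x ∈ G.edgeSet, Sym2.map e x ∈ G'.edgeSet := by
    intro x
    induction x using Sym2.ind with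
    | _ a b => exact e.map_adj_iff.2
  have hsurj : ∀ x ∈ G'.edgeSet, ∃ y ∈ G.edgeSet, Sym2.map e y = x := by
    intro x
    induction x using Sym2.ind with
    | _ a b =>
      intro hab
      exact ⟨s(e.symm a, e.symm b), e.symm.map_adj_iff.2 hab, by simp⟩
  have hmem : ∀ (x : Sym2 V) (w : V), e w ∈ Sym2.map e x ↔ w ∈ x := by
    intro x w
    simp [Sym2.mem_map]
  let D' : PlaneDrawing G :=
    { point := fun v => D.point (e v)
      arc := fun x => D.arc (Sym2.map e x)
      point_injective := D.point_injective.comp e.injective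
      isPolygonalArc := fun u v h => D.isPolygonalArc _ _ (e.map_adj_iff.2 h)
      mem_of_point_mem_arc := fun x hx w hw =>
        (hmem x w).1 (D.mem_of_point_mem_arc _ (hedge x hx) _ hw)
      arc_inter_arc := by
        intro x hx y hy hxy p hp
        obtain ⟨w, h1, h2, h3⟩ := D.arc_inter_arc _ (hedge x hx) _ (hedge y hy)
          ((Sym2.map.injective e.injective).ne hxy) p hp
        refine ⟨e.symm w, ?_, ?_, by simpa using h3⟩
        · rw [← hmem]; simpa using h1
        · rw [← hmem]; simpa using h2 }
  have hsupp : D'.support = D.support := by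
    unfold PlaneDrawing.support
    congr 1
    · exact e.surjective.range_comp D.point
    · ext p
      simp only [mem_iUnion, exists_prop]
      constructor
      · rintro ⟨x, hx, hp⟩
        exact ⟨_, hedge x hx, hp⟩
      · rintro ⟨x, hx, hp⟩
        obtain ⟨y, hy, rfl⟩ := hsurj x hx
        exact ⟨y, hy, hp⟩
  refine ⟨D', fun v => ?_⟩
  have : D'.outerFace = D.outerFace := by
    unfold PlaneDrawing.outerFace
    rw [hsupp]
  rw [this]
  exact hD (e v)

/-! ### The spectral radius as the maximum of the quadratic form -/

section Perron

open scoped Classical in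
/-- The entries of the real adjacency matrix. -/
noncomputable def adj {V : Type*} (G : SimpleGraph V) (v w : V) : ℝ := if G.Adj v w then 1 else 0

variable {V : Type*} (G : SimpleGraph V)

theorem adj_nonneg (v w : V) : 0 ≤ adj G v w := by
  unfold adj
  split_ifs <;> norm_num

theorem adj_le_one (v w : V) : adj G v w ≤ 1 := by
  unfold adj
  split_ifs <;> norm_num

variable {G} in
theorem adj_eq_one {v w : V} (h : G.Adj v w) : adj G v w = 1 := by
  rw [adj, if_pos h]

variable {G} in
theorem adj_eq_zero {v w : V} (h : ¬ G.Adj v w) : adj G v w = 0 := by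
  rw [adj, if_neg h]

theorem adj_comm (v w : V) : adj G v w = adj G w v := by
  by_cases h : G.Adj v w
  · rw [adj_eq_one h, adj_eq_one h.symm]
  · rw [adj_eq_zero h, adj_eq_zero fun h' => h h'.symm]

theorem adj_iso {W : Type*} {G : SimpleGraph V} {H : SimpleGraph W} (e : G ≃g H) (v w : V) :
    adj G v w = adj H (e v) (e w) := by
  by_cases h : G.Adj v w
  · rw [adj_eq_one h, adj_eq_one (e.map_adj_iff.2 h)]
  · rw [adj_eq_zero h, adj_eq_zero fun h' => h (e.map_adj_iff.1 h')]

variable [Fintype V]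

/-- The quadratic form of a graph. -/
noncomputable def quadForm (y : V → ℝ) : ℝ := ∑ v, y v * ∑ w, adj G v w * y w

theorem quadForm_le_abs (y : V → ℝ) : quadForm G y ≤ quadForm G fun v => |y v| := by
  unfold quadForm
  refine Finset.sum_le_sum fun v _ => ?_
  rw [Finset.mul_sum, Finset.mul_sum]
  refine Finset.sum_le_sum fun w _ => ?_
  have h := le_abs_self (y v * y w)
  rw [abs_mul] at h
  nlinarith [mul_le_mul_of_nonneg_left h (adj_nonneg G v w)]

theorem quadForm_smul (r : ℝ) (y : V → ℝ) : quadForm G (r • y) = r ^ 2 * quadForm G y := by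
  unfold quadForm
  rw [Finset.mul_sum]
  refine Finset.sum_congr rfl fun v _ => ?_
  rw [Finset.mul_sum, Finset.mul_sum, Finset.mul_sum]
  refine Finset.sum_congr rfl fun w _ => ?_
  simp only [Pi.smul_apply, smul_eq_mul]
  ring

theorem quadForm_nonneg {y : V → ℝ} (hy : ∀ v, 0 ≤ y v) : 0 ≤ quadForm G y :=
  Finset.sum_nonneg fun v _ => mul_nonneg (hy v)
    (Finset.sum_nonneg fun w _ => mul_nonneg (adj_nonneg G v w) (hy w))

/-- `l` is the spectral radius of `G`, together with its variational characterization. -/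
structure IsPerronValue (l : ℝ) : Prop where
  nonneg : 0 ≤ l
  rho_eq : rho G = ENNReal.ofReal l
  exists_eigenvector : ∃ x : V → ℝ, (∀ v, 0 ≤ x v) ∧ x ≠ 0 ∧ ∀ v, ∑ w, adj G v w * x w = l * x v
  quadForm_le : ∀ y : V → ℝ, quadForm G y ≤ l * ∑ v, y v ^ 2
  eigen_of_eq : ∀ y : V → ℝ, quadForm G y = l * ∑ v, y v ^ 2 →
    ∀ v, ∑ w, adj G v w * y w = l * y v

-- The matrix `l - A` is positive semidefinite, and a zero of a positive semidefinite form lies in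
-- the kernel.
open scoped Classical in
theorem eigen_of_quadForm_eq {l : ℝ} (hle : ∀ y : V → ℝ, quadForm G y ≤ l * ∑ v, y v ^ 2)
    {y : V → ℝ} (hy : quadForm G y = l * ∑ v, y v ^ 2) (v : V) :
    ∑ w, adj G v w * y w = l * y v := by
  have hmul : ∀ (z : V → ℝ) (v : V),
      ((l • (1 : Matrix V V ℝ) - G.adjMatrix ℝ).mulVec z) v = l * z v - ∑ w, adj G v w * z w := by
    intro z v
    rw [Matrix.sub_mulVec, Matrix.smul_mulVec, Matrix.one_mulVec]
    simp only [Pi.sub_apply, Pi.smul_apply, smul_eq_mul, Matrix.mulVec, dotProduct,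
      SimpleGraph.adjMatrix_apply, adj]
  have hdot : ∀ z : V → ℝ,
      Star.star z ⬝ᵥ ((l • (1 : Matrix V V ℝ) - G.adjMatrix ℝ).mulVec z) =
        l * ∑ v, z v ^ 2 - quadForm G z := by
    intro z
    simp only [dotProduct, hmul, Pi.star_apply, star_trivial, quadForm, mul_sub,
      Finset.sum_sub_distrib, Finset.mul_sum]
    congr 1
    exact Finset.sum_congr rfl fun v _ => by ring
  have hpsd : (l • (1 : Matrix V V ℝ) - G.adjMatrix ℝ).PosSemidef := by
    refine Matrix.PosSemidef.of_dotProduct_mulVec_nonneg ?_ fun z => ?_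
    · refine Matrix.IsHermitian.sub ?_ ?_
      · ext i j
        simp [Matrix.one_apply, eq_comm]
      · ext i j
        simp [G.adj_comm]
    · rw [hdot]
      linarith [hle z]
  have h0 := (hpsd.dotProduct_mulVec_zero_iff y).1 (by rw [hdot, hy, sub_self])
  have := congrFun h0 v
  rw [hmul] at this
  simp only [Pi.zero_apply] at this
  linarith

/-- Compactness of the unit sphere; since the entries of the matrix are nonnegative, a maximizer may
be replaced by its absolute value. -/
theorem exists_max_quadForm [Nonempty V] : ∃ l : ℝ, ∃ x : V → ℝ, (∀ v, 0 ≤ x v) ∧ x ≠ 0 ∧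
    quadForm G x = l * ∑ v, x v ^ 2 ∧ ∀ y : V → ℝ, quadForm G y ≤ l * ∑ v, y v ^ 2 := by
  classical
  have hcont : Continuous (quadForm G) := by
    unfold quadForm
    fun_prop
  have hcomp : IsCompact {y : V → ℝ | ∑ v, y v ^ 2 = 1} := by
    refine Metric.isCompact_of_isClosed_isBounded (isClosed_eq (by fun_prop) continuous_const) ?_
    refine (Metric.isBounded_closedBall (x := 0) (r := 1)).subset fun y hy => ?_
    rw [mem_closedBall_zero_iff, pi_norm_le_iff_of_nonneg zero_le_one]
    intro v
    have : y v ^ 2 ≤ ∑ v, y v ^ 2 :=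
      Finset.single_le_sum (f := fun v => y v ^ 2) (fun _ _ => sq_nonneg _) (Finset.mem_univ v)
    rw [Real.norm_eq_abs]
    apply abs_le_of_sq_le_sq _ zero_le_one
    rw [one_pow]
    exact this.trans (le_of_eq hy)
  have hne : {y : V → ℝ | ∑ v, y v ^ 2 = 1}.Nonempty := by
    obtain ⟨v⟩ := ‹Nonempty V›
    refine ⟨Pi.single v 1, ?_⟩
    simp [Pi.single_apply]
  obtain ⟨x, hx, hmax⟩ := hcomp.exists_isMaxOn hne hcont.continuousOn
  have hle : ∀ y : V → ℝ, quadForm G y ≤ quadForm G x * ∑ v, y v ^ 2 := by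
    intro y
    set s := ∑ v, y v ^ 2 with hs
    have hs0 : 0 ≤ s := Finset.sum_nonneg fun _ _ => sq_nonneg _
    rcases hs0.eq_or_lt with h | h
    · have hy : y = 0 := by
        have := (Finset.sum_eq_zero_iff_of_nonneg (fun v _ => sq_nonneg (y v))).1 h.symm
        funext v
        simpa using this v (Finset.mem_univ v)
      rw [← h, hy]
      simp [quadForm]
    · have hr : (Real.sqrt s)⁻¹ ^ 2 = s⁻¹ := by
        rw [inv_pow, Real.sq_sqrt hs0]
      have hmem : (Real.sqrt s)⁻¹ • y ∈ {y : V → ℝ | ∑ v, y v ^ 2 = 1} := by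
        simp only [mem_ofPred_eq, Pi.smul_apply, smul_eq_mul, mul_pow]
        rw [← Finset.mul_sum, hr, ← hs, inv_mul_cancel₀ h.ne']
      have hm : quadForm G ((Real.sqrt s)⁻¹ • y) ≤ quadForm G x := hmax hmem
      rw [quadForm_smul, hr, inv_mul_le_iff₀ h] at hm
      linarith
  have hx1 : ∑ v, x v ^ 2 = 1 := hx
  refine ⟨quadForm G x, fun v => |x v|, fun v => abs_nonneg _, ?_, ?_, hle⟩
  · intro h0
    have : x = 0 := by
      funext v
      simpa using congrFun h0 v
    rw [this] at hx1
    simp at hx1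
  · refine le_antisymm (hle _) ?_
    simp only [sq_abs]
    rw [hx1, mul_one]
    exact quadForm_le_abs G x

-- A complex eigenvector `z` for `k` satisfies `|k| |z| ≤ A |z|` entrywise, so testing the form on
-- `|z|` gives `|k| ≤ l`; the maximizer itself shows that `l` is an eigenvalue.
open scoped Classical in
theorem exists_isPerronValue [Nonempty V] : ∃ l, IsPerronValue G l := by
  obtain ⟨l, x, hx0, hx, hxl, hle⟩ := exists_max_quadForm G
  have heig := eigen_of_quadForm_eq G hle hxl
  have hpos : 0 < ∑ v, x v ^ 2 := by
    obtain ⟨v, hv⟩ := Function.ne_iff.1 hx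
    exact Finset.sum_pos' (fun _ _ => sq_nonneg _) ⟨v, Finset.mem_univ v, by
      have : x v ≠ 0 := hv
      positivity⟩
  have hl : 0 ≤ l := by
    have := quadForm_nonneg G hx0
    rw [hxl] at this
    exact nonneg_of_mul_nonneg_left this hpos
  refine ⟨l, hl, ?_, ⟨x, hx0, hx, heig⟩, hle, fun y hy => eigen_of_quadForm_eq G hle hy⟩
  have hmem : ∀ k : ℂ, k ∈ spectrum ℂ (G.adjMatrix ℂ) ↔
      ∃ z : V → ℂ, z ≠ 0 ∧ ∀ v, ∑ w, (adj G v w : ℂ) * z w = k * z v := by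
    intro k
    have hvec : ∀ (z : V → ℂ) v, (Matrix.toLin' (G.adjMatrix ℂ) z) v =
        ∑ w, (adj G v w : ℂ) * z w := by
      intro z v
      rw [Matrix.toLin'_apply]
      simp only [Matrix.mulVec, dotProduct, SimpleGraph.adjMatrix_apply, adj]
      refine Finset.sum_congr rfl fun w _ => ?_
      split_ifs <;> simp
    rw [← Matrix.spectrum_toLin', ← Module.End.hasEigenvalue_iff_mem_spectrum]
    constructor
    · intro h
      obtain ⟨z, hz⟩ := h.exists_hasEigenvector
      refine ⟨z, hz.2, fun v => ?_⟩
      rw [← hvec, hz.apply_eq_smul]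
      rfl
    · rintro ⟨z, hz, hzv⟩
      refine Module.End.hasEigenvalue_of_hasEigenvector (x := z) ⟨?_, hz⟩
      rw [Module.End.mem_eigenspace_iff]
      funext v
      rw [hvec, hzv]
      rfl
  unfold rho spectralRadius
  apply le_antisymm
  · refine iSup₂_le fun k hk => ?_
    obtain ⟨z, hz, hzv⟩ := (hmem k).1 hk
    rw [← enorm_eq_nnnorm, ← ofReal_norm]
    apply ENNReal.ofReal_le_ofReal
    have h1 := hle fun v => ‖z v‖
    have h2 : ‖k‖ * ∑ v, ‖z v‖ ^ 2 ≤ quadForm G fun v => ‖z v‖ := by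
      unfold quadForm
      rw [Finset.mul_sum]
      refine Finset.sum_le_sum fun v _ => ?_
      have h3 : ‖k‖ * ‖z v‖ ≤ ∑ w, adj G v w * ‖z w‖ := by
        rw [← norm_mul, ← hzv v]
        refine (norm_sum_le _ _).trans (le_of_eq ?_)
        refine Finset.sum_congr rfl fun w _ => ?_
        rw [norm_mul, Complex.norm_real, Real.norm_of_nonneg (adj_nonneg G v w)]
      nlinarith [mul_le_mul_of_nonneg_left h3 (norm_nonneg (z v))]
    have hzpos : 0 < ∑ v, ‖z v‖ ^ 2 := by
      obtain ⟨v, hv⟩ := Function.ne_iff.1 hz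
      exact Finset.sum_pos' (fun _ _ => sq_nonneg _) ⟨v, Finset.mem_univ v, by
        have : z v ≠ 0 := hv
        positivity⟩
    exact le_of_mul_le_mul_right (h2.trans h1) hzpos
  · have hk : (l : ℂ) ∈ spectrum ℂ (G.adjMatrix ℂ) := by
      rw [hmem]
      refine ⟨fun v => (x v : ℂ), ?_, fun v => ?_⟩
      · intro h0
        apply hx
        funext v
        simpa using congrFun h0 v
      · have := congrArg (fun r : ℝ => (r : ℂ)) (heig v)
        push_cast at this
        exact this
    refine le_trans ?_ (le_iSup₂ (f := fun k (_ : k ∈ spectrum ℂ (G.adjMatrix ℂ)) =>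
      (‖k‖₊ : ℝ≥0∞)) (l : ℂ) hk)
    rw [← enorm_eq_nnnorm, ← ofReal_norm, Complex.norm_real, Real.norm_of_nonneg hl]

variable {G} in
theorem quadForm_iso {W : Type*} [Fintype W] {H : SimpleGraph W} (e : G ≃g H) (y : W → ℝ) :
    quadForm G (fun v => y (e v)) = quadForm H y := by
  unfold quadForm
  refine Fintype.sum_equiv e.toEquiv _ _ fun v => ?_
  congr 1
  refine Fintype.sum_equiv e.toEquiv _ _ fun w => ?_
  rw [adj_iso e]
  rfl

variable {G} in
theorem IsPerronValue.le_of_forall {l m : ℝ} (hl : IsPerronValue G l)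
    (hm : ∀ y : V → ℝ, quadForm G y ≤ m * ∑ v, y v ^ 2) : l ≤ m := by
  obtain ⟨x, hx0, hx, heig⟩ := hl.exists_eigenvector
  have hpos : 0 < ∑ v, x v ^ 2 := by
    obtain ⟨v, hv⟩ := Function.ne_iff.1 hx
    exact Finset.sum_pos' (fun _ _ => sq_nonneg _) ⟨v, Finset.mem_univ v, by
      have : x v ≠ 0 := hv
      positivity⟩
  have h1 : quadForm G x = l * ∑ v, x v ^ 2 := by
    unfold quadForm
    rw [Finset.mul_sum]
    exact Finset.sum_congr rfl fun v _ => by rw [heig]; ring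
  exact le_of_mul_le_mul_right (h1 ▸ hm x) hpos

variable {G} in
theorem IsPerronValue.of_iso {W : Type*} [Fintype W] {H : SimpleGraph W} (e : G ≃g H) {l m : ℝ}
    (hl : IsPerronValue G l) (hm : IsPerronValue H m) : l = m := by
  apply le_antisymm
  · refine hl.le_of_forall fun y => ?_
    have h1 := hm.quadForm_le fun w => y (e.symm w)
    rw [quadForm_iso e.symm y] at h1
    rw [show ∑ v, y v ^ 2 = ∑ w, y (e.symm w) ^ 2 from
      (Fintype.sum_equiv e.symm.toEquiv _ _ fun v => rfl).symm]
    exact h1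
  · refine hm.le_of_forall fun y => ?_
    have h1 := hl.quadForm_le fun w => y (e w)
    rw [quadForm_iso e y] at h1
    rw [show ∑ v, y v ^ 2 = ∑ w, y (e w) ^ 2 from
      (Fintype.sum_equiv e.toEquiv _ _ fun v => rfl).symm]
    exact h1

end Perron

/-! ### Matchings and vertex covers -/

section Matching

variable {V : Type*} {G : SimpleGraph V}

/-- `G` has a matching with `k` edges. -/
def HasMatching (G : SimpleGraph V) (k : ℕ) : Prop :=
  ∃ f : Fin k → Fin 2 → V, (∀ i j i' j', f i j = f i' j' → i = i' ∧ j = j') ∧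
    ∀ i, G.Adj (f i 0) (f i 1)

theorem hasMatching_iff (k : ℕ) : HasMatching G k ↔ (copiesK2 k).IsContained G := by
  constructor
  · rintro ⟨f, hf, hadj⟩
    refine ⟨⟨⟨fun x => f x.1 x.2, ?_⟩, ?_⟩⟩
    · rintro ⟨i, a⟩ ⟨j, b⟩ ⟨rfl, h⟩
      have := hadj i
      simp only at h ⊢
      fin_cases a <;> fin_cases b <;> first | exact absurd rfl h | exact this | exact this.symm
    · rintro ⟨i, a⟩ ⟨j, b⟩ h
      obtain ⟨rfl, rfl⟩ := hf _ _ _ _ h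
      rfl
  · rintro ⟨φ⟩
    refine ⟨fun i j => φ (i, j), fun i j i' j' h => ?_, fun i => ?_⟩
    · have := φ.injective h
      exact ⟨congrArg Prod.fst this, congrArg Prod.snd this⟩
    · exact φ.toHom.map_adj ⟨rfl, by simp⟩

theorem hasMatching_zero : HasMatching G 0 := ⟨fun i => i.elim0, fun i => i.elim0, fun i => i.elim0⟩

theorem hasMatching_succ {k : ℕ} {f : Fin k → Fin 2 → V}
    (hf : ∀ i j i' j', f i j = f i' j' → i = i' ∧ j = j') (hadj : ∀ i, G.Adj (f i 0) (f i 1))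
    {v w : V} (hvw : G.Adj v w) (hv : ∀ i j, f i j ≠ v) (hw : ∀ i j, f i j ≠ w) :
    HasMatching G (k + 1) := by
  refine ⟨Fin.cons ![v, w] f, fun i j i' j' => ?_, fun i => ?_⟩
  · have hne := hvw.ne
    have hne' := hvw.ne.symm
    refine Fin.cases ?_ (fun i => ?_) i <;> refine Fin.cases ?_ (fun i' => ?_) i'
    · fin_cases j <;> fin_cases j' <;> simp [hne, hne']
    · fin_cases j
      · intro h; exact absurd h.symm (hv _ _)
      · intro h; exact absurd h.symm (hw _ _)
    · fin_cases j'
      · intro h; exact absurd h (hv _ _)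
      · intro h; exact absurd h (hw _ _)
    · intro h
      obtain ⟨h1, h2⟩ := hf i j i' j' h
      exact ⟨congrArg Fin.succ h1, h2⟩
  · refine Fin.cases ?_ (fun i => ?_) i
    · exact hvw
    · exact hadj i

theorem HasMatching.of_le {k l : ℕ} (h : HasMatching G k) (hlk : l ≤ k) : HasMatching G l := by
  obtain ⟨f, hf, hadj⟩ := h
  refine ⟨fun i => f (Fin.castLE hlk i), fun i j i' j' h => ?_, fun i => hadj _⟩
  obtain ⟨h1, h2⟩ := hf _ _ _ _ h
  exact ⟨Fin.castLE_injective hlk h1, h2⟩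

/-- A matching is not larger than a vertex cover. -/
theorem not_hasMatching_of_cover {k : ℕ} (C : Finset V) (hC : C.card < k)
    (hcov : ∀ v w, G.Adj v w → v ∈ C ∨ w ∈ C) : ¬ HasMatching G k := by
  rintro ⟨f, hf, hadj⟩
  have h : ∀ i, ∃ j, f i j ∈ C := fun i => (hcov _ _ (hadj i)).elim (fun h => ⟨0, h⟩) fun h => ⟨1, h⟩
  choose j hj using h
  have := Finset.card_le_card_of_injOn (s := Finset.univ) (t := C) (fun i : Fin k => f i (j i))
    (fun i _ => hj i) (fun i _ i' _ h => (hf _ _ _ _ h).1)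
  simp only [Finset.card_univ, Fintype.card_fin] at this
  omega

end Matching

/-! ### Matchings and leaves of linear forests -/

section LinearForest

variable {W : Type*} {H : SimpleGraph W}

theorem exists_longest_path [Finite W] [Nonempty W] (H : SimpleGraph W) :
    ∃ (u v : W) (p : H.Walk u v), p.IsPath ∧
      ∀ (u' v' : W) (q : H.Walk u' v'), q.IsPath → q.length ≤ p.length := by
  classical
  have := Fintype.ofFinite W
  let P : ℕ → Prop := fun l => ∃ (u v : W) (p : H.Walk u v), p.IsPath ∧ p.length = l
  have hP0 : P 0 := by
    obtain ⟨w⟩ := ‹Nonempty W›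
    exact ⟨w, w, SimpleGraph.Walk.nil, by simp, rfl⟩
  obtain ⟨u, v, p, hp, hl⟩ := Nat.findGreatest_spec (P := P) (Nat.zero_le (Fintype.card W)) hP0
  refine ⟨u, v, p, hp, fun u' v' q hq => ?_⟩
  rw [hl]
  exact Nat.le_findGreatest hq.length_lt.le ⟨u', v', q, hq, rfl⟩

/-- A neighbour of the first vertex off the path would prolong it; one on the path is its second
vertex, because paths in a forest are unique. -/
theorem eq_getVert_one_of_longest (hac : H.IsAcyclic) {u v : W} {p : H.Walk u v} (hp : p.IsPath)
    (hmax : ∀ (u' v' : W) (q : H.Walk u' v'), q.IsPath → q.length ≤ p.length) {x : W}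
    (hx : H.Adj u x) : x = p.getVert 1 ∧ 1 ≤ p.length := by
  classical
  by_cases hxp : x ∈ p.support
  · have h1 := hp.takeUntil hxp
    have h2 : (SimpleGraph.Walk.cons hx SimpleGraph.Walk.nil).IsPath := by
      simp [SimpleGraph.Walk.cons_isPath_iff, hx.ne]
    have hs := hac.subsingleton_path u x
    have h3 := hs.elim ⟨_, h1⟩ ⟨_, h2⟩
    have h4 : p.takeUntil x hxp = SimpleGraph.Walk.cons hx SimpleGraph.Walk.nil :=
      congrArg Subtype.val h3
    have h5 := p.getVert_length_takeUntil hxp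
    have h6 := p.length_takeUntil_le_length hxp
    rw [h4] at h5 h6
    exact ⟨h5.symm, h6⟩
  · have h1 : (SimpleGraph.Walk.cons hx.symm p).IsPath :=
      (SimpleGraph.Walk.cons_isPath_iff _ _).2 ⟨hp, hxp⟩
    have := hmax _ _ _ h1
    simp at this

theorem exists_leaf [Finite W] (hac : H.IsAcyclic) {a b : W} (hab : H.Adj a b) :
    ∃ u x, H.Adj u x ∧ ∀ y, H.Adj u y → y = x := by
  have : Nonempty W := ⟨a⟩
  obtain ⟨u, v, p, hp, hmax⟩ := exists_longest_path H
  have hl : 1 ≤ p.length := by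
    have h2 : (SimpleGraph.Walk.cons hab SimpleGraph.Walk.nil).IsPath := by
      simp [SimpleGraph.Walk.cons_isPath_iff, hab.ne]
    simpa using hmax _ _ _ h2
  refine ⟨u, p.getVert 1, ?_, fun y hy => (eq_getVert_one_of_longest hac hp hmax hy).1⟩
  have := p.adj_getVert_succ (i := 0) (by omega)
  simpa using this

-- Take a leaf `v` with neighbour `w` and delete all edges at `w`. At most two edges are lost, and
-- `v` and `w` become isolated, so `vw` can be added to a matching of the rest.
open scoped Classical in
theorem exists_hasMatching_of_acyclic [Fintype W] (hac : H.IsAcyclic) (hdeg : ∀ v, H.degree v ≤ 2) :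
    ∃ k, HasMatching H k ∧ H.edgeFinset.card ≤ 2 * k := by
  induction hn : H.edgeFinset.card using Nat.strong_induction_on generalizing H with
  | _ n ih =>
    subst hn
    by_cases he : H.edgeFinset.card = 0
    · exact ⟨0, hasMatching_zero, by omega⟩
    obtain ⟨e, he⟩ := Finset.card_pos.1 (Nat.pos_of_ne_zero he)
    rw [SimpleGraph.mem_edgeFinset] at he
    obtain ⟨a, b, hab⟩ : ∃ a b, H.Adj a b := by
      induction e using Sym2.ind with
      | _ a b => exact ⟨a, b, he⟩
    obtain ⟨v, w, hvw, hv⟩ := exists_leaf hac hab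
    obtain ⟨H', hle, hadj', hcard, hdeg'⟩ : ∃ H' : SimpleGraph W, H' ≤ H ∧
        (∀ x y, H'.Adj x y → x ≠ w ∧ y ≠ w) ∧
        H'.edgeFinset.card = H.edgeFinset.card - H.degree w ∧ ∀ v, H'.degree v ≤ 2 := by
      refine ⟨H.deleteIncidenceSet w, H.deleteIncidenceSet_le w, fun x y h => ?_, ?_, fun z => ?_⟩
      · rw [SimpleGraph.deleteIncidenceSet_adj] at h
        exact h.2
      · convert! H.card_edgeFinset_deleteIncidenceSet w
      · refine le_trans (le_of_eq ?_)
          ((SimpleGraph.degree_le_of_le (H.deleteIncidenceSet_le w)).trans (hdeg z))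
        congr!
    have hw0 : 0 < H.degree w := (H.degree_pos_iff_exists_adj w).2 ⟨v, hvw.symm⟩
    have hw2 := hdeg w
    have hpos := Finset.card_pos.2 ⟨e, SimpleGraph.mem_edgeFinset.2 he⟩
    obtain ⟨k, ⟨f, hf, hadj⟩, hk⟩ := ih _ (by omega) (hac.anti hle) hdeg' rfl
    have hfw : ∀ i j, f i j ≠ w := by
      intro i j h
      have := hadj' _ _ (hadj i)
      fin_cases j
      · exact this.1 h
      · exact this.2 h
    have hfv : ∀ i j, f i j ≠ v := by
      intro i j h
      have hi := hadj i
      fin_cases j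
      · simp only [Fin.zero_eta] at h
        rw [h] at hi
        exact hfw i 1 (hv _ (hle hi))
      · simp only [Fin.mk_one] at h
        rw [h] at hi
        exact hfw i 0 (hv _ (hle hi.symm))
    exact ⟨k + 1, hasMatching_succ hf (fun i => hle (hadj i)) hvw hfv hfw, by omega⟩

/-- A longest path of a linear forest, as a component. -/
theorem exists_path_component [Finite W] [Nonempty W] (hac : H.IsAcyclic)
    (hdeg : ∀ v x y z, H.Adj v x → H.Adj v y → H.Adj v z → x = y ∨ x = z ∨ y = z) :
    ∃ (L : ℕ) (g : Fin (L + 1) → W), Function.Injective g ∧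
      (∀ i x, H.Adj (g i) x → ∃ j, g j = x) ∧
      (∀ i j, H.Adj (g i) (g j) ↔ (SimpleGraph.pathGraph (L + 1)).Adj i j) ∧
      (∀ a b, H.Adj a b → 1 ≤ L) := by
  obtain ⟨u, v, p, hp, hmax⟩ := exists_longest_path H
  have hinj := hp.getVert_injOn
  have hend : ∀ x, H.Adj (p.getVert p.length) x → x = p.getVert (p.length - 1) ∧ 1 ≤ p.length := by
    intro x hx
    have hmax' : ∀ (u' v' : W) (q : H.Walk u' v'), q.IsPath → q.length ≤ p.reverse.length := by
      simpa using hmax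
    rw [SimpleGraph.Walk.getVert_length] at hx
    have := eq_getVert_one_of_longest hac hp.reverse hmax' hx
    rwa [SimpleGraph.Walk.getVert_reverse, SimpleGraph.Walk.length_reverse] at this
  have hnbr : ∀ i ≤ p.length, ∀ x, H.Adj (p.getVert i) x →
      ∃ j ≤ p.length, p.getVert j = x ∧ (i + 1 = j ∨ j + 1 = i) := by
    intro i hi x hx
    rcases Nat.eq_zero_or_pos i with rfl | hi0
    · rw [SimpleGraph.Walk.getVert_zero] at hx
      obtain ⟨h1, h2⟩ := eq_getVert_one_of_longest hac hp hmax hx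
      exact ⟨1, h2, h1.symm, Or.inl rfl⟩
    · rcases hi.eq_or_lt with rfl | hil
      · obtain ⟨h1, h2⟩ := hend x hx
        exact ⟨p.length - 1, by omega, h1.symm, by omega⟩
      · have a1 := p.adj_getVert_succ hil
        have a2 := p.adj_getVert_succ (i := i - 1) (by omega)
        rw [Nat.sub_add_cancel hi0] at a2
        -- An inner vertex already has two neighbours on the path, so the degree bound leaves no
        -- third one.
        rcases hdeg _ _ _ _ a1 a2.symm hx with h | h | h
        · have := hinj (show i + 1 ≤ p.length by omega) (show i - 1 ≤ p.length by omega) h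
          omega
        · exact ⟨i + 1, by omega, h, Or.inl rfl⟩
        · exact ⟨i - 1, by omega, h, by omega⟩
  refine ⟨p.length, fun i => p.getVert i, ?_, ?_, ?_, ?_⟩
  · intro i j h
    exact Fin.ext (hinj (show (i : ℕ) ≤ p.length by omega) (show (j : ℕ) ≤ p.length by omega) h)
  · intro i x hx
    obtain ⟨j, hj, hjx, -⟩ := hnbr i (by omega) x hx
    exact ⟨⟨j, by omega⟩, hjx⟩
  · intro i j
    rw [SimpleGraph.pathGraph_adj]
    constructor
    · intro h
      obtain ⟨j', hj', h1, h2⟩ := hnbr i (by omega) _ h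
      have : j' = (j : ℕ) := hinj hj' (show (j : ℕ) ≤ p.length by omega) h1
      omega
    · rintro (h | h)
      · simp only [← h]
        exact p.adj_getVert_succ (by omega)
      · simp only [← h]
        exact (p.adj_getVert_succ (by omega)).symm
  · intro a b hab
    have h2 : (SimpleGraph.Walk.cons hab SimpleGraph.Walk.nil).IsPath := by
      simp [SimpleGraph.Walk.cons_isPath_iff, hab.ne]
    simpa using hmax _ _ _ h2

/-- A linear forest with at most two leaves is a path together with isolated vertices. -/
theorem exists_iso_path_of_leaves [Fintype W] [Nonempty W] (hac : H.IsAcyclic)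
    (hdeg : ∀ v x y z, H.Adj v x → H.Adj v y → H.Adj v z → x = y ∨ x = z ∨ y = z)
    (hleaf : ∀ x y z : W, (∃! a, H.Adj x a) → (∃! a, H.Adj y a) → (∃! a, H.Adj z a) →
      x = y ∨ x = z ∨ y = z) :
    ∃ L b : ℕ, Nonempty ((SimpleGraph.pathGraph (L + 1)) ⊕g (⊥ : SimpleGraph (Fin b)) ≃g H) := by
  classical
  obtain ⟨L, g, hg, hcl, hpath, hL⟩ := exists_path_component hac hdeg
  -- An edge off the path would yield a leaf of another component, a third one besides the two ends
  -- of the path. These ends are different leaves because the longest path has at least one edge.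
  have hout : ∀ a b, H.Adj a b → a ∈ range g := by
    intro a b hab
    by_contra ha
    have hclosed : ∀ x y, H.Adj x y → x ∉ range g → y ∉ range g := by
      rintro x y hxy hx ⟨j, rfl⟩
      obtain ⟨i, hi⟩ := hcl j x hxy.symm
      exact hx ⟨i, hi⟩
    have hL1 := hL a b hab
    have hab' : (H.induce (range g)ᶜ).Adj ⟨a, ha⟩ ⟨b, hclosed a b hab ha⟩ := hab
    obtain ⟨z, x, hzx, hz⟩ := exists_leaf (hac.induce _) hab'
    have l1 : ∃! y, H.Adj z.1 y := by
      refine ⟨x.1, hzx, fun y hy => ?_⟩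
      have := hz ⟨y, hclosed _ _ hy z.2⟩ hy
      exact congrArg Subtype.val this
    have l2 : ∃! y, H.Adj (g 0) y := by
      refine ⟨g ⟨1, by omega⟩, (hpath _ _).2 ?_, fun y hy => ?_⟩
      · rw [SimpleGraph.pathGraph_adj]; simp
      · obtain ⟨j, rfl⟩ := hcl _ _ hy
        rw [hpath, SimpleGraph.pathGraph_adj] at hy
        congr 1
        ext
        simp at hy ⊢
        omega
    have l3 : ∃! y, H.Adj (g (Fin.last L)) y := by
      refine ⟨g ⟨L - 1, by omega⟩, (hpath _ _).2 ?_, fun y hy => ?_⟩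
      · rw [SimpleGraph.pathGraph_adj]; simp; omega
      · obtain ⟨j, rfl⟩ := hcl _ _ hy
        rw [hpath, SimpleGraph.pathGraph_adj] at hy
        congr 1
        ext
        simp at hy ⊢
        omega
    rcases hleaf _ _ _ l1 l2 l3 with h | h | h
    · exact z.2 ⟨_, h.symm⟩
    · exact z.2 ⟨_, h.symm⟩
    · have := congrArg Fin.val (hg h)
      simp at this
      omega
  let e : Fin (L + 1) ⊕ Fin (Fintype.card ↥(range g)ᶜ) ≃ W :=
    (Equiv.sumCongr (Equiv.ofInjective g hg) (Fintype.equivFin _).symm).trans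
      (Equiv.Set.sumCompl (range g))
  have e1 : ∀ i, e (Sum.inl i) = g i := fun i => by simp [e]
  have e2 : ∀ j, e (Sum.inr j) ∉ range g := fun j => by
    have h2 : e (Sum.inr j) = ((Fintype.equivFin ↥(range g)ᶜ).symm j).1 := by simp [e]
    rw [h2]
    exact ((Fintype.equivFin ↥(range g)ᶜ).symm j).2
  refine ⟨L, _, ⟨⟨e, ?_⟩⟩⟩
  rintro (i | i) (j | j)
  · rw [e1, e1, hpath]
    simp
  · constructor
    · intro h
      exact absurd (hout _ _ h.symm) (e2 j)
    · intro h
      simp at h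
  · constructor
    · intro h
      exact absurd (hout _ _ h) (e2 i)
    · intro h
      simp at h
  · constructor
    · intro h
      exact absurd (hout _ _ h) (e2 i)
    · intro h
      simp at h

end LinearForest

/-! ### The spectral radius of a join with one vertex -/

section Join

variable {W : Type*} [Fintype W] (H : SimpleGraph W)

/-- The degree of a vertex, as a real number. -/
noncomputable def degR (v : W) : ℝ := ∑ w, adj H v w

theorem degR_nonneg (v : W) : 0 ≤ degR H v := Finset.sum_nonneg fun w _ => adj_nonneg H v w

open scoped Classical in
theorem degR_eq (v : W) : degR H v = H.degree v := by
  unfold degR adj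
  rw [Finset.sum_boole, SimpleGraph.degree, SimpleGraph.neighborFinset_eq_filter]

open scoped Classical in
theorem sum_degR : ∑ v, degR H v = 2 * (H.edgeFinset.card : ℝ) := by
  simp only [degR_eq]
  exact_mod_cast H.sum_degrees_eq_twice_card_edges

variable {H} in
theorem sum_degR_iso {W' : Type*} [Fintype W'] {H' : SimpleGraph W'} (e : H ≃g H') :
    ∑ v, degR H v = ∑ v, degR H' v := by
  refine Fintype.sum_equiv e.toEquiv _ _ fun v => ?_
  exact Fintype.sum_equiv e.toEquiv _ _ fun w => adj_iso e v w

omit [Fintype W] in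
theorem join_adj_inl (a b : Fin 1) : adj (join (⊤ : SimpleGraph (Fin 1)) H)
    (Sum.inl a) (Sum.inl b) = 0 :=
  adj_eq_zero (by rw [Subsingleton.elim a b]; exact SimpleGraph.irrefl _)

omit [Fintype W] in
theorem join_adj_inl_inr (a : Fin 1) (w : W) :
    adj (join (⊤ : SimpleGraph (Fin 1)) H) (Sum.inl a) (Sum.inr w) = 1 :=
  adj_eq_one (by simp [join])

omit [Fintype W] in
theorem join_adj_inr_inl (a : Fin 1) (w : W) :
    adj (join (⊤ : SimpleGraph (Fin 1)) H) (Sum.inr w) (Sum.inl a) = 1 :=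
  adj_eq_one (by simp [join])

omit [Fintype W] in
theorem join_adj_inr (v w : W) :
    adj (join (⊤ : SimpleGraph (Fin 1)) H) (Sum.inr v) (Sum.inr w) = adj H v w := by
  by_cases h : H.Adj v w
  · rw [adj_eq_one h, adj_eq_one (by simpa [join] using h)]
  · rw [adj_eq_zero h, adj_eq_zero (by simpa [join] using h)]

variable {H}

/-- The eigenvector is scaled to be `1` at the centre; its entry there cannot vanish, since the
equation at the centre would then make every other entry zero. -/
theorem IsPerronValue.exists_join {l : ℝ}
    (hl : IsPerronValue (join (⊤ : SimpleGraph (Fin 1)) H) l) :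
    ∃ z : W → ℝ, (∀ v, 0 ≤ z v) ∧ l = ∑ v, z v ∧ ∀ v, l * z v = 1 + ∑ w, adj H v w * z w := by
  obtain ⟨x, hx0, hx, heig⟩ := hl.exists_eigenvector
  have h1 : ∑ w, x (Sum.inr w) = l * x (Sum.inl 0) := by
    have := heig (Sum.inl 0)
    simpa [Fintype.sum_sum_type, join_adj_inl, join_adj_inl_inr] using this
  have h2 : ∀ v, x (Sum.inl 0) + ∑ w, adj H v w * x (Sum.inr w) = l * x (Sum.inr v) := by
    intro v
    have := heig (Sum.inr v)
    simpa [Fintype.sum_sum_type, join_adj_inr_inl, join_adj_inr] using this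
  have hpos : 0 < x (Sum.inl 0) := by
    refine lt_of_le_of_ne (hx0 _) fun h0 => hx ?_
    rw [← h0, mul_zero] at h1
    funext v
    rcases v with v | v
    · rw [Subsingleton.elim v 0, ← h0]
      rfl
    · exact (Finset.sum_eq_zero_iff_of_nonneg fun w _ => hx0 (Sum.inr w)).1 h1 v (Finset.mem_univ v)
  refine ⟨fun v => x (Sum.inr v) / x (Sum.inl 0), fun v => div_nonneg (hx0 _) hpos.le, ?_,
    fun v => ?_⟩
  · rw [← Finset.sum_div, h1, mul_div_cancel_right₀ _ hpos.ne']
  · have h3 : ∑ w, adj H v w * (x (Sum.inr w) / x (Sum.inl 0)) =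
        (∑ w, adj H v w * x (Sum.inr w)) / x (Sum.inl 0) := by
      rw [Finset.sum_div]
      exact Finset.sum_congr rfl fun w _ => by ring
    rw [h3, ← mul_div_assoc, ← h2 v]
    field_simp

/-- The characteristic equation of a join with a vertex, expanded to third order. -/
theorem join_expansion {l : ℝ} {z : W → ℝ} (hl : l = ∑ v, z v)
    (hz : ∀ v, l * z v = 1 + ∑ w, adj H v w * z w) :
    l ^ 2 - Fintype.card W = ∑ v, degR H v * z v ∧
    l * (l * (l ^ 2 - Fintype.card W)) = l * ∑ v, degR H v + ∑ v, degR H v ^ 2 +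
      ∑ v, (∑ w, adj H v w * degR H w) * ∑ w, adj H v w * z w := by
  have swap : ∀ f g : W → ℝ, ∑ v, f v * ∑ w, adj H v w * g w = ∑ v, (∑ w, adj H v w * f w) * g v := by
    intro f g
    simp only [Finset.mul_sum, Finset.sum_mul]
    rw [Finset.sum_comm]
    refine Finset.sum_congr rfl fun v _ => Finset.sum_congr rfl fun w _ => ?_
    rw [adj_comm H w v]
    ring
  -- Each application gains one order in `1/l`; it is used for the constant `1`, for the degrees
  -- `d`, and for `A d`, where `∑ A d = ∑ d²`.
  have step : ∀ f : W → ℝ, l * ∑ v, f v * z v = ∑ v, f v + ∑ v, (∑ w, adj H v w * f w) * z v := by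
    intro f
    rw [← swap, Finset.mul_sum, ← Finset.sum_add_distrib]
    refine Finset.sum_congr rfl fun v _ => ?_
    rw [show l * (f v * z v) = f v * (l * z v) by ring, hz]
    ring
  have s1 := step fun _ => 1
  simp only [one_mul, mul_one, Finset.sum_const, Finset.card_univ, nsmul_eq_mul] at s1
  rw [← hl] at s1
  have e1 : l ^ 2 - Fintype.card W = ∑ v, degR H v * z v := by
    have : ∑ v, degR H v * z v = ∑ v, (∑ w, adj H v w) * z v := rfl
    rw [this]
    linarith
  refine ⟨e1, ?_⟩
  rw [e1, step, mul_add]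
  have s3 := step fun v => ∑ w, adj H v w * degR H w
  rw [s3, add_assoc]
  congr 1
  congr 1
  · have h1 : ∑ v, ∑ w, adj H v w * degR H w = ∑ v, 1 * ∑ w, adj H v w * degR H w := by simp
    rw [h1, swap]
    refine Finset.sum_congr rfl fun v _ => ?_
    simp only [mul_one]
    rw [sq]
    rfl
  · rw [swap]

theorem IsPerronValue.join_lower {l : ℝ}
    (hl : IsPerronValue (join (⊤ : SimpleGraph (Fin 1)) H) l) :
    (Fintype.card W : ℝ) ≤ l ^ 2 ∧
      l * ∑ v, degR H v + ∑ v, degR H v ^ 2 ≤ l * (l * (l ^ 2 - Fintype.card W)) := by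
  obtain ⟨z, hz0, hlz, hz⟩ := hl.exists_join
  obtain ⟨e1, e2⟩ := join_expansion hlz hz
  constructor
  · have : 0 ≤ ∑ v, degR H v * z v :=
      Finset.sum_nonneg fun v _ => mul_nonneg (degR_nonneg H v) (hz0 v)
    linarith
  · rw [e2]
    have : 0 ≤ ∑ v, (∑ w, adj H v w * degR H w) * ∑ w, adj H v w * z w :=
      Finset.sum_nonneg fun v _ => mul_nonneg
        (Finset.sum_nonneg fun w _ => mul_nonneg (adj_nonneg H v w) (degR_nonneg H w))
        (Finset.sum_nonneg fun w _ => mul_nonneg (adj_nonneg H v w) (hz0 w))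
    linarith

/-- The equation at a maximum of `z` gives `z ≤ 1/(l - 2)`, so the third-order term is at most `(∑
d²) · 2/(l - 2)`. Together with `∑ d²` this makes the factor `l/(l - 2)`. -/
theorem IsPerronValue.join_upper {l : ℝ}
    (hl : IsPerronValue (join (⊤ : SimpleGraph (Fin 1)) H) l) (hl2 : 2 < l)
    (hdeg : ∀ v, degR H v ≤ 2) :
    l * (l ^ 2 - Fintype.card W) ≤ ∑ v, degR H v + (∑ v, degR H v ^ 2) / (l - 2) := by
  obtain ⟨z, hz0, hlz, hz⟩ := hl.exists_join
  obtain ⟨-, e2⟩ := join_expansion hlz hz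
  have hpos : 0 < l - 2 := by linarith
  have hbound : ∀ v, z v ≤ 1 / (l - 2) := by
    rcases isEmpty_or_nonempty W with hW | hW
    · exact fun v => isEmptyElim v
    obtain ⟨u, hu⟩ := Finite.exists_max z
    have h1 : ∑ w, adj H u w * z w ≤ 2 * z u := by
      calc ∑ w, adj H u w * z w ≤ ∑ w, adj H u w * z u :=
            Finset.sum_le_sum fun w _ => mul_le_mul_of_nonneg_left (hu w) (adj_nonneg H u w)
        _ = degR H u * z u := by rw [degR, Finset.sum_mul]
        _ ≤ 2 * z u := mul_le_mul_of_nonneg_right (hdeg u) (hz0 u)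
    intro v
    refine (hu v).trans ?_
    rw [le_div_iff₀ hpos]
    have := hz u
    nlinarith
  have h3 : ∑ v, (∑ w, adj H v w * degR H w) * ∑ w, adj H v w * z w ≤
      (∑ v, degR H v ^ 2) * (2 / (l - 2)) := by
    have h4 : ∑ v, degR H v ^ 2 = ∑ v, ∑ w, adj H v w * degR H w := by
      rw [Finset.sum_comm]
      refine Finset.sum_congr rfl fun v _ => ?_
      rw [← Finset.sum_mul, sq]
      congr 1
      exact Finset.sum_congr rfl fun w _ => adj_comm H v w
    rw [h4, Finset.sum_mul]
    refine Finset.sum_le_sum fun v _ => mul_le_mul_of_nonneg_left ?_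
      (Finset.sum_nonneg fun w _ => mul_nonneg (adj_nonneg H v w) (degR_nonneg H w))
    calc ∑ w, adj H v w * z w ≤ ∑ w, adj H v w * (1 / (l - 2)) :=
          Finset.sum_le_sum fun w _ => mul_le_mul_of_nonneg_left (hbound w) (adj_nonneg H v w)
      _ = degR H v * (1 / (l - 2)) := by rw [degR, Finset.sum_mul]
      _ ≤ 2 * (1 / (l - 2)) := mul_le_mul_of_nonneg_right (hdeg v) (by positivity)
      _ = 2 / (l - 2) := by ring
  have hlpos : 0 < l := by linarith
  have h5 : l * (l * (l ^ 2 - Fintype.card W)) ≤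
      l * (∑ v, degR H v + (∑ v, degR H v ^ 2) / (l - 2)) := by
    rw [e2]
    have : l * (∑ v, degR H v + (∑ v, degR H v ^ 2) / (l - 2)) =
        l * ∑ v, degR H v + ∑ v, degR H v ^ 2 + (∑ v, degR H v ^ 2) * (2 / (l - 2)) := by
      field_simp
      ring
    rw [this]
    linarith
  exact le_of_mul_le_mul_left h5 hlpos

/-- An isomorphism of graphs extends to the joins with a vertex. -/
def joinIso {W W' : Type*} {H : SimpleGraph W} {H' : SimpleGraph W'} (e : H ≃g H') :
    join (⊤ : SimpleGraph (Fin 1)) H ≃g join (⊤ : SimpleGraph (Fin 1)) H' where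
  toEquiv := Equiv.sumCongr (Equiv.refl _) e.toEquiv
  map_rel_iff' := by
    rintro (a | a) (b | b)
    · simp [join]
    · simp [join]
    · simp [join]
    · simpa [join] using e.map_adj_iff

end Join

/-! ### Degree sums of a path with isolated vertices -/

section Path

theorem degR_path_inl (L b : ℕ) (i : Fin (L + 1)) :
    degR (SimpleGraph.pathGraph (L + 1) ⊕g (⊥ : SimpleGraph (Fin b))) (Sum.inl i) =
      (if (i : ℕ) < L then 1 else 0) + (if 0 < (i : ℕ) then 1 else 0) := by
  unfold degR
  rw [Fintype.sum_sum_type]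
  have h2 : ∑ w : Fin b, adj (SimpleGraph.pathGraph (L + 1) ⊕g (⊥ : SimpleGraph (Fin b)))
      (Sum.inl i) (Sum.inr w) = 0 :=
    Finset.sum_eq_zero fun w _ => adj_eq_zero (by simp)
  have h1 : ∀ j : Fin (L + 1), adj (SimpleGraph.pathGraph (L + 1) ⊕g (⊥ : SimpleGraph (Fin b)))
      (Sum.inl i) (Sum.inl j) =
      (if (j : ℕ) = i + 1 then 1 else 0) + (if (j : ℕ) + 1 = i then 1 else 0) := by
    intro j
    by_cases h : (SimpleGraph.pathGraph (L + 1)).Adj i j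
    · rw [adj_eq_one (by simpa using h)]
      rw [SimpleGraph.pathGraph_adj] at h
      split_ifs <;> first | omega | norm_num
    · rw [adj_eq_zero (by simpa using h)]
      rw [SimpleGraph.pathGraph_adj] at h
      split_ifs <;> first | omega | norm_num
  rw [h2, add_zero, Finset.sum_congr rfl fun j _ => h1 j, Finset.sum_add_distrib]
  congr 1
  · rw [Fin.sum_univ_eq_sum_range fun j => if j = (i : ℕ) + 1 then (1 : ℝ) else 0,
      Finset.sum_ite_eq']
    simp
  · rw [Fin.sum_univ_eq_sum_range fun j => if j + 1 = (i : ℕ) then (1 : ℝ) else 0]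
    have hi := i.2
    rcases Nat.eq_zero_or_pos (i : ℕ) with h | h
    · rw [h]
      simp
    · rw [if_pos h, Finset.sum_congr rfl fun j _ => if_congr
        (show j + 1 = (i : ℕ) ↔ j = (i : ℕ) - 1 by omega) rfl rfl, Finset.sum_ite_eq',
        if_pos (Finset.mem_range.2 (by omega))]

theorem degR_path_inr (L b : ℕ) (i : Fin b) :
    degR (SimpleGraph.pathGraph (L + 1) ⊕g (⊥ : SimpleGraph (Fin b))) (Sum.inr i) = 0 := by
  refine Finset.sum_eq_zero fun w _ => adj_eq_zero ?_
  rcases w with w | w <;> simp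

theorem sum_degR_path (L b : ℕ) :
    ∑ v, degR (SimpleGraph.pathGraph (L + 1) ⊕g (⊥ : SimpleGraph (Fin b))) v = 2 * L := by
  rw [Fintype.sum_sum_type]
  simp only [degR_path_inl, degR_path_inr, Finset.sum_const_zero, add_zero,
    Finset.sum_add_distrib]
  rw [Fin.sum_univ_eq_sum_range fun j => if j < L then (1 : ℝ) else 0,
    Fin.sum_univ_eq_sum_range fun j => if 0 < j then (1 : ℝ) else 0, Finset.sum_range_succ,
    Finset.sum_range_succ', Finset.sum_congr rfl fun j hj => if_pos (Finset.mem_range.1 hj)]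
  simp
  ring

/-- Sums `d² ≥ 3d - 2` over the path vertices; this is sharp for the degrees `1` and `2`, and an
inequality is kept so that the one-vertex path is included. -/
theorem sum_degR_sq_path (L b : ℕ) : (4 * L - 2 : ℝ) ≤
    ∑ v, degR (SimpleGraph.pathGraph (L + 1) ⊕g (⊥ : SimpleGraph (Fin b))) v ^ 2 := by
  have h := sum_degR_path L b
  rw [Fintype.sum_sum_type] at h ⊢
  simp only [degR_path_inr, Finset.sum_const_zero, add_zero, ne_eq, OfNat.ofNat_ne_zero,
    not_false_eq_true, zero_pow] at h ⊢
  have h2 : ∑ i : Fin (L + 1), (3 * degR (SimpleGraph.pathGraph (L + 1) ⊕g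
      (⊥ : SimpleGraph (Fin b))) (Sum.inl i) - 2) ≤ ∑ i : Fin (L + 1),
      degR (SimpleGraph.pathGraph (L + 1) ⊕g (⊥ : SimpleGraph (Fin b))) (Sum.inl i) ^ 2 := by
    refine Finset.sum_le_sum fun i _ => ?_
    rw [degR_path_inl]
    split_ifs <;> norm_num
  rw [Finset.sum_sub_distrib, ← Finset.mul_sum, h] at h2
  simp only [Finset.sum_const, Finset.card_univ, Fintype.card_fin, nsmul_eq_mul] at h2
  push_cast at h2
  linarith

end Path

/-! ### Comparison of linear forests -/

section Compare

variable {W : Type*} [Fintype W] {H : SimpleGraph W}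

open scoped Classical in
/-- Among the joins of a vertex and a linear forest with matching number less than `t`, the one with
the path on `2t - 1` vertices has the largest spectral radius. -/
theorem join_iso_of_le {t b : ℕ} (ht : 1 ≤ t) (hb : 2 * t - 1 + b = Fintype.card W)
    (hac : H.IsAcyclic)
    (hdeg : ∀ v x y z, H.Adj v x → H.Adj v y → H.Adj v z → x = y ∨ x = z ∨ y = z)
    (hmat : ¬ HasMatching H t) {l s : ℝ}
    (hl : IsPerronValue (join (⊤ : SimpleGraph (Fin 1)) H) l)
    (hs : IsPerronValue (join (⊤ : SimpleGraph (Fin 1))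
      (SimpleGraph.pathGraph (2 * t - 1) ⊕g (⊥ : SimpleGraph (Fin b)))) s)
    (hsl : s ≤ l) (hlt : 16 * (t : ℝ) ≤ l) :
    Nonempty (H ≃g SimpleGraph.pathGraph (2 * t - 1) ⊕g (⊥ : SimpleGraph (Fin b))) := by
  obtain ⟨r, rfl⟩ : ∃ r, t = r + 1 := ⟨t - 1, by omega⟩
  rw [show 2 * (r + 1) - 1 = 2 * r + 1 by omega] at hb hs ⊢
  have hd2 : ∀ v, H.degree v ≤ 2 := by
    intro v
    by_contra! h
    obtain ⟨x, y, z, hx, hy, hz, hxy, hxz, hyz⟩ := Finset.two_lt_card_iff.1 h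
    rw [SimpleGraph.mem_neighborFinset] at hx hy hz
    rcases hdeg v x y z hx hy hz with h | h | h <;> contradiction
  have hdR : ∀ v, degR H v ≤ 2 := fun v => by
    rw [degR_eq]
    exact_mod_cast hd2 v
  obtain ⟨k, hk, hek⟩ := exists_hasMatching_of_acyclic hac hd2
  have hkr : k ≤ r := by
    by_contra! h
    exact hmat (hk.of_le h)
  have hW : Nonempty W := Fintype.card_pos_iff.1 (by omega)
  push_cast at hlt
  have hr0 : (0 : ℝ) ≤ r := Nat.cast_nonneg r
  have hl2 : 2 < l := by linarith
  have up := hl.join_upper hl2 hdR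
  obtain ⟨lo1, lo2⟩ := hs.join_lower
  have hcard : Fintype.card (Fin (2 * r + 1) ⊕ Fin b) = Fintype.card W := by
    simp [← hb]
  rw [hcard] at lo1 lo2
  rw [sum_degR_path] at lo2
  rw [sum_degR] at up
  have hW1 : (1 : ℝ) ≤ Fintype.card W := by
    exact_mod_cast Nat.one_le_iff_ne_zero.2 Fintype.card_ne_zero
  have hs0 : 0 < s := by
    refine lt_of_le_of_ne hs.nonneg fun h => ?_
    rw [← h] at lo1
    norm_num at lo1
  set m : ℝ := (Fintype.card W : ℝ) with hm
  set Q := ∑ v, degR H v ^ 2 with hQ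
  set Qs := ∑ v, degR (SimpleGraph.pathGraph (2 * r + 1) ⊕g (⊥ : SimpleGraph (Fin b))) v ^ 2
    with hQs
  have hQs0 : 0 ≤ Qs := Finset.sum_nonneg fun _ _ => sq_nonneg _
  have hQs1 := sum_degR_sq_path (2 * r) b
  push_cast at hQs1 lo2
  -- The lower bound for the candidate is moved from `s` to the larger `l`, so that both expansions
  -- are compared at the same point.
  have hlo : 2 * (2 * r) + Qs / l ≤ l * (l ^ 2 - m) := by
    have h1 : 2 * (2 * r) + Qs / s ≤ s * (s ^ 2 - m) := by
      refine le_of_mul_le_mul_left ?_ hs0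
      rw [mul_add, mul_div_cancel₀ _ hs0.ne']
      exact lo2
    have h2 : Qs / l ≤ Qs / s := div_le_div_of_nonneg_left hQs0 hs0 hsl
    have h3 : s ^ 2 ≤ l ^ 2 := by nlinarith
    have h4 : s * (s ^ 2 - m) ≤ l * (l ^ 2 - m) :=
      mul_le_mul hsl (by linarith) (by linarith) (by linarith)
    linarith
  have hmain := hlo.trans up
  have hl2' : 0 < l - 2 := by linarith
  have hlpos : 0 < l := by linarith
  have hQsum : Q = 4 * H.edgeFinset.card - ∑ v, (2 * degR H v - degR H v ^ 2) := by
    rw [Finset.sum_sub_distrib, ← Finset.mul_sum, sum_degR]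
    ring
  have hterm : ∀ v, 0 ≤ 2 * degR H v - degR H v ^ 2 := fun v => by
    nlinarith [hdR v, degR_nonneg H v]
  have hQ4 : Q ≤ 4 * H.edgeFinset.card := by
    have := Finset.sum_nonneg fun v (_ : v ∈ Finset.univ) => hterm v
    linarith
  have her : H.edgeFinset.card ≤ 2 * r := by omega
  -- With an edge missing, the first-order term drops by at least `2`, while the second-order term
  -- of `H` is at most `1`.
  rcases her.lt_or_eq with h | h
  · exfalso
    have h1 : (H.edgeFinset.card : ℝ) + 1 ≤ 2 * r := by exact_mod_cast h
    have h2 : Q / (l - 2) ≤ 1 := by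
      rw [div_le_one hl2']
      linarith
    have h3 : 0 ≤ Qs / l := by positivity
    linarith
  · by_cases hleaf : ∀ x y z : W, (∃! a, H.Adj x a) → (∃! a, H.Adj y a) → (∃! a, H.Adj z a) →
      x = y ∨ x = z ∨ y = z
    · obtain ⟨L, b', ⟨e⟩⟩ := exists_iso_path_of_leaves hac hdeg hleaf
      have h1 := sum_degR_iso e
      rw [sum_degR_path, sum_degR, h] at h1
      have h2 : L = 2 * r := by
        have : (L : ℝ) = (2 * r : ℕ) := by linarith
        exact_mod_cast this
      subst h2
      have h3 := Fintype.card_congr e.toEquiv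
      simp only [Fintype.card_sum, Fintype.card_fin] at h3
      have h4 : b' = b := by omega
      subst h4
      exact ⟨e.symm⟩
    · exfalso
      push Not at hleaf
      obtain ⟨x, y, z, hx, hy, hz, hxy, hxz, hyz⟩ := hleaf
      have hone : ∀ v, (∃! a, H.Adj v a) → 2 * degR H v - degR H v ^ 2 = 1 := by
        intro v hv
        rw [degR_eq, SimpleGraph.degree_eq_one_iff_existsUnique_adj.2 hv]
        norm_num
      -- For degrees at most two, `2d - d²` is `1` at a leaf and `0` elsewhere, so this sum counts
      -- leaves. Three leaves give `Q ≤ 8r - 3` against `Qs ≥ 8r - 2`, which forces `l ≤ 16r - 4`.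
      have h3 : 3 ≤ ∑ v, (2 * degR H v - degR H v ^ 2) := by
        have h5 := Finset.sum_le_sum_of_subset_of_nonneg (Finset.subset_univ ({x, y, z} : Finset W))
          fun v _ _ => hterm v
        rw [Finset.sum_insert (by simp [hxy, hxz]), Finset.sum_insert (by simp [hyz]),
          Finset.sum_singleton, hone x hx, hone y hy, hone z hz] at h5
        linarith
      have h4 : Q ≤ 8 * r - 3 := by
        rw [hQsum, h]
        push_cast
        linarith
      have h5 : Qs / l ≤ Q / (l - 2) := by
        rw [h] at hmain
        push_cast at hmain
        linarith
      rw [div_le_div_iff₀ hlpos hl2'] at h5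
      have h6 : (8 * r - 2) * (l - 2) ≤ Qs * (l - 2) :=
        mul_le_mul_of_nonneg_right (by linarith) hl2'.le
      have h7 : Q * l ≤ (8 * r - 3) * l := mul_le_mul_of_nonneg_right h4 hlpos.le
      nlinarith

end Compare

/-! ### A vertex of almost full degree -/

section Localization

variable {V : Type*} {G : SimpleGraph V}

/-- Any two vertices have at most two common neighbours. -/
def CodegreeLeTwo (G : SimpleGraph V) : Prop :=
  ∀ a b c₁ c₂ c₃, a ≠ b → G.Adj a c₁ → G.Adj a c₂ → G.Adj a c₃ → G.Adj c₁ b → G.Adj c₂ b →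
    G.Adj c₃ b → c₁ = c₂ ∨ c₁ = c₃ ∨ c₂ = c₃

theorem IsOuterplanar.codegreeLeTwo (h : IsOuterplanar G) : CodegreeLeTwo G := by
  obtain ⟨D, hD⟩ := h
  intro a b c₁ c₂ c₃ hab h1 h2 h3 h4 h5 h6
  by_contra! hne
  exact D.false_of_k23 hD hab hne.1 hne.2.1 hne.2.2 h1 h2 h3 h4 h5 h6

/-- The neighbourhood of `u` with the edges of `G` inside it; the other vertices are isolated. -/
def linkGraph (G : SimpleGraph V) (u : V) : SimpleGraph {v // v ≠ u} where
  Adj a b := G.Adj a b ∧ G.Adj u a ∧ G.Adj u b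
  symm := ⟨fun _ _ h => ⟨h.1.symm, h.2.2, h.2.1⟩⟩
  loopless := ⟨fun _ h => G.irrefl h.1⟩

theorem adj_linkGraph (u : V) (a b : {v // v ≠ u}) :
    adj (linkGraph G u) a b = adj G u a * adj G u b * adj G a b := by
  by_cases h1 : G.Adj a b
  · by_cases h2 : G.Adj u a
    · by_cases h3 : G.Adj u b
      · have h : (linkGraph G u).Adj a b := ⟨h1, h2, h3⟩
        rw [adj_eq_one h1, adj_eq_one h2, adj_eq_one h3, adj_eq_one h]
        norm_num
      · have h : ¬ (linkGraph G u).Adj a b := fun h => h3 h.2.2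
        rw [adj_eq_zero h3, adj_eq_zero h]
        ring
    · have h : ¬ (linkGraph G u).Adj a b := fun h => h2 h.2.1
      rw [adj_eq_zero h2, adj_eq_zero h]
      ring
  · have h : ¬ (linkGraph G u).Adj a b := fun h => h1 h.1
    rw [adj_eq_zero h1, adj_eq_zero h]
    ring

variable [Fintype V]

open scoped Classical in
theorem CodegreeLeTwo.sum_le (hG : CodegreeLeTwo G) {a b : V} (hab : a ≠ b) :
    ∑ w, adj G a w * adj G w b ≤ 2 := by
  have h1 : ∀ w, adj G a w * adj G w b = if G.Adj a w ∧ G.Adj w b then 1 else 0 := by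
    intro w
    by_cases h : G.Adj a w <;> by_cases h' : G.Adj w b <;> simp [adj, h, h']
  simp only [h1, Finset.sum_boole]
  by_contra! hlt
  have h2 : 2 < (Finset.univ.filter fun w => G.Adj a w ∧ G.Adj w b).card := by exact_mod_cast hlt
  obtain ⟨x, y, z, hx, hy, hz, hxy, hxz, hyz⟩ := Finset.two_lt_card_iff.1 h2
  simp only [Finset.mem_filter, Finset.mem_univ, true_and] at hx hy hz
  rcases hG a b x y z hab hx.1 hy.1 hz.1 hx.2 hy.2 hz.2 with h | h | h <;> contradiction

open scoped Classical in
/-- Up to few exceptions, the vertices of a graph with a small cover have degree at most one. -/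
theorem exists_exceptional_set (hG : CodegreeLeTwo G) (S : Finset V)
    (hcov : ∀ v w, G.Adj v w → v ∈ S ∨ w ∈ S) :
    ∃ B : Finset V, B.card ≤ 2 * S.card ^ 2 ∧
      ∀ v ∉ B, ∀ a b, G.Adj v a → G.Adj v b → a = b := by
  -- The cover and the common neighbours of its pairs: outside the cover all neighbours are in `S`,
  -- so two of them make the vertex such a common neighbour.
  refine ⟨S ∪ S.offDiag.biUnion fun p =>
    Finset.univ.filter fun w => G.Adj p.1 w ∧ G.Adj w p.2, ?_, ?_⟩
  · have h1 : (S.offDiag.biUnion fun p =>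
        Finset.univ.filter fun w => G.Adj p.1 w ∧ G.Adj w p.2).card ≤ S.offDiag.card * 2 := by
      refine Finset.card_biUnion_le_card_mul _ _ _ fun p hp => ?_
      by_contra! hlt
      obtain ⟨x, y, z, hx, hy, hz, hxy, hxz, hyz⟩ := Finset.two_lt_card_iff.1 hlt
      simp only [Finset.mem_filter, Finset.mem_univ, true_and] at hx hy hz
      rcases hG _ _ x y z (Finset.mem_offDiag.1 hp).2.2 hx.1 hy.1 hz.1 hx.2 hy.2 hz.2 with
        h | h | h <;> contradiction
    rw [Finset.offDiag_card] at h1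
    have h2 := Finset.card_union_le S (S.offDiag.biUnion fun p =>
        Finset.univ.filter fun w => G.Adj p.1 w ∧ G.Adj w p.2)
    have h3 : S.card ≤ S.card * S.card := Nat.le_mul_self _
    rw [sq]
    omega
  · intro v hv a b ha hb
    by_contra hab
    simp only [Finset.mem_union, not_or, Finset.mem_biUnion, Finset.mem_filter, Finset.mem_univ,
      true_and, not_exists, not_and] at hv
    exact hv.2 (a, b) (Finset.mem_offDiag.2 ⟨(hcov v a ha).resolve_left hv.1,
      (hcov v b hb).resolve_left hv.1, hab⟩) ha.symm hb

/-- A Perron eigenvector that is scaled to have maximum `1`. -/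
theorem IsPerronValue.exists_max_eq_one {l : ℝ} (hl : IsPerronValue G l) :
    ∃ (x : V → ℝ) (u : V), (∀ v, 0 ≤ x v) ∧ (∀ v, x v ≤ 1) ∧ x u = 1 ∧
      ∀ v, ∑ w, adj G v w * x w = l * x v := by
  obtain ⟨x, hx0, hx, heig⟩ := hl.exists_eigenvector
  obtain ⟨v, hv⟩ := Function.ne_iff.1 hx
  have : Nonempty V := ⟨v⟩
  obtain ⟨u, hu⟩ := Finite.exists_max x
  have hpos : 0 < x u := (lt_of_le_of_ne (hx0 v) (Ne.symm hv)).trans_le (hu v)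
  refine ⟨fun v => x v / x u, u, fun v => div_nonneg (hx0 v) hpos.le,
    fun v => (div_le_one hpos).2 (hu v), div_self hpos.ne', fun v => ?_⟩
  rw [← mul_div_assoc, ← heig, Finset.sum_div]
  exact Finset.sum_congr rfl fun w _ => by ring

section Estimates

variable {l : ℝ} {x : V → ℝ} {u : V} (hx0 : ∀ v, 0 ≤ x v) (hx1 : ∀ v, x v ≤ 1) (hu : x u = 1)
  (heig : ∀ v, ∑ w, adj G v w * x w = l * x v) {B : Finset V}
  (hB : ∀ v ∉ B, ∀ a b, G.Adj v a → G.Adj v b → a = b)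

include heig hB in
theorem mul_le_of_notMem {v a : V} (hv : v ∉ B) (ha : G.Adj v a) : l * x v ≤ x a := by
  rw [← heig v, Finset.sum_eq_single a]
  · rw [adj_eq_one ha, one_mul]
  · intro b _ hba
    rw [adj_eq_zero fun h => hba (hB v hv b a h ha), zero_mul]
  · simp

-- Vertices in `B` contribute at most `1` each, all others at most `1/l`.
include hx1 heig hB in
theorem sum_eigenvector_le (hl0 : 1 ≤ l) (hn : (Fintype.card V : ℝ) ≤ l ^ 2 + 1)
    (hBl : (B.card : ℝ) ≤ l / 4) : ∑ v, x v ≤ 5 / 4 * l + 1 := by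
  classical
  have hlpos : 0 < l := by linarith
  have h1 : ∀ v, x v ≤ (if v ∈ B then 1 else 0) + 1 / l := by
    intro v
    have hinv : 0 ≤ 1 / l := by positivity
    by_cases hv : v ∈ B
    · rw [if_pos hv]
      linarith [hx1 v]
    · rw [if_neg hv, zero_add, le_div_iff₀ hlpos, mul_comm]
      by_cases ha : ∃ a, G.Adj v a
      · obtain ⟨a, ha⟩ := ha
        exact (mul_le_of_notMem heig hB hv ha).trans (hx1 a)
      · rw [← heig v, Finset.sum_eq_zero fun w _ => ?_]
        · norm_num
        · rw [adj_eq_zero fun h => ha ⟨w, h⟩, zero_mul]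
  refine (Finset.sum_le_sum fun v _ => h1 v).trans ?_
  rw [Finset.sum_add_distrib, Finset.sum_boole, Finset.sum_const, Finset.card_univ, nsmul_eq_mul,
    Finset.filter_mem_eq_inter, Finset.univ_inter]
  have h2 : (Fintype.card V : ℝ) * (1 / l) ≤ l + 1 := by
    rw [mul_one_div, div_le_iff₀ hlpos]
    nlinarith
  linarith

-- Evaluate `A² x = l² x` at `u`: the diagonal entry of `A²` is the degree, and every other entry is
-- at most `2`.
include hx0 hx1 hu heig hB in
theorem le_degR_max (hG : CodegreeLeTwo G) (hl0 : 1 ≤ l)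
    (hn : (Fintype.card V : ℝ) ≤ l ^ 2 + 1) (hBl : (B.card : ℝ) ≤ l / 4) :
    l ^ 2 - 5 / 2 * l - 2 ≤ degR G u := by
  classical
  have hsum := sum_eigenvector_le hx1 heig hB hl0 hn hBl
  have h1 : l ^ 2 = ∑ z, (∑ w, adj G u w * adj G w z) * x z := by
    calc l ^ 2 = l * (l * x u) := by rw [hu]; ring
      _ = ∑ w, adj G u w * (l * x w) := by
          rw [← heig u, Finset.mul_sum]
          exact Finset.sum_congr rfl fun w _ => by ring
      _ = ∑ w, ∑ z, adj G u w * adj G w z * x z := by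
          refine Finset.sum_congr rfl fun w _ => ?_
          rw [← heig w, Finset.mul_sum]
          exact Finset.sum_congr rfl fun z _ => by ring
      _ = _ := by
          rw [Finset.sum_comm]
          exact Finset.sum_congr rfl fun z _ => by rw [Finset.sum_mul]
  have h2 : ∀ z, (∑ w, adj G u w * adj G w z) * x z ≤
      (if z = u then degR G u else 0) + 2 * x z := by
    intro z
    split_ifs with h
    · subst h
      rw [hu]
      have : ∑ w, adj G z w * adj G w z ≤ degR G z := by
        refine Finset.sum_le_sum fun w _ => ?_
        exact mul_le_of_le_one_right (adj_nonneg G z w) (adj_le_one G w z)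
      linarith
    · rw [zero_add]
      exact mul_le_mul_of_nonneg_right (hG.sum_le (Ne.symm h)) (hx0 z)
  have h3 : l ^ 2 ≤ degR G u + 2 * ∑ z, x z := by
    rw [h1]
    refine (Finset.sum_le_sum fun z _ => h2 z).trans (le_of_eq ?_)
    rw [Finset.sum_add_distrib, Finset.sum_ite_eq', if_pos (Finset.mem_univ u), Finset.mul_sum]
  linarith

include hx0 hx1 hu heig hB in
/-- A vertex that is not adjacent to the maximum of the eigenvector has a small entry. -/
theorem mul_lt_one_of_not_adj (hG : CodegreeLeTwo G) (hl0 : 100 ≤ l)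
    (hn : (Fintype.card V : ℝ) ≤ l ^ 2 + 1) (hBl : (B.card : ℝ) ≤ l / 4) {w : V} (hw : w ≠ u)
    (hwu : ¬ G.Adj w u) : l * x w < 1 := by
  classical
  have hlpos : 0 < l := by linarith
  have hdeg := le_degR_max hx0 hx1 hu heig hB hG (by linarith) hn hBl
  -- The argument bootstraps from the second largest entry `x m`, which turns out to be at most
  -- `1/(l/2 + 1)`.
  obtain ⟨m, hm, hmax⟩ := (Finset.univ.erase u).exists_max_image x ⟨w, by simp [hw]⟩
  have hmu : m ≠ u := by simpa using hm
  have hmax' : ∀ z, z ≠ u → x z ≤ x m := fun z hz => hmax z (by simp [hz])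
  have hM0 := hx0 m
  -- The neighbours of `v` other than `u` fall into at most two common neighbours with `u`, at most
  -- `l/4` vertices of `B`, and at most `3l` non-neighbours of `u` with entries at most `x m / l`.
  -- The sum `2 + l/4 + 3` is below `l/2 - 1` for `l ≥ 100`.
  have hT : ∀ v, v ≠ u → ∑ z, (if z = u then 0 else adj G v z * x z) ≤ (l / 2 - 1) * x m := by
    intro v hv
    have h1 : ∀ z, (if z = u then 0 else adj G v z * x z) ≤
        (adj G v z * adj G z u) * x m + ((if z ∈ B then 1 else 0) * x m +
          (1 - adj G u z) * (x m / l)) := by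
      intro z
      have t1 : 0 ≤ (adj G v z * adj G z u) * x m :=
        mul_nonneg (mul_nonneg (adj_nonneg _ _ _) (adj_nonneg _ _ _)) hM0
      have t2 : 0 ≤ (if z ∈ B then (1 : ℝ) else 0) * x m := by
        split_ifs <;> linarith
      have t3 : 0 ≤ (1 - adj G u z) * (x m / l) :=
        mul_nonneg (by linarith [adj_le_one G u z]) (by positivity)
      by_cases hz : z = u
      · rw [if_pos hz]
        linarith
      rw [if_neg hz]
      by_cases hvz : G.Adj v z
      swap
      · rw [adj_eq_zero hvz, zero_mul] at *
        linarith
      have hzm := hmax' z hz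
      by_cases hzu : G.Adj z u
      · rw [adj_eq_one hvz, adj_eq_one hzu]
        linarith
      · by_cases hzB : z ∈ B
        · rw [if_pos hzB, adj_eq_one hvz, adj_eq_zero hzu]
          linarith
        · have h2 := mul_le_of_notMem heig hB hzB hvz.symm
          have h3 : x z ≤ x m / l := by
            rw [le_div_iff₀ hlpos, mul_comm]
            exact h2.trans (hmax' v hv)
          rw [adj_eq_zero (v := u) (w := z) fun h => hzu h.symm, adj_eq_one hvz, adj_eq_zero hzu,
            if_neg hzB]
          linarith
    refine (Finset.sum_le_sum fun z _ => h1 z).trans ?_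
    rw [Finset.sum_add_distrib, Finset.sum_add_distrib, ← Finset.sum_mul, ← Finset.sum_mul,
      ← Finset.sum_mul, Finset.sum_boole, Finset.filter_mem_eq_inter, Finset.univ_inter,
      Finset.sum_sub_distrib]
    simp only [Finset.sum_const, Finset.card_univ, nsmul_eq_mul, mul_one]
    have h4 := hG.sum_le hv
    have h5 : (Fintype.card V - ∑ z, adj G u z) * (x m / l) ≤ 3 * x m := by
      have h6 : (Fintype.card V : ℝ) - degR G u ≤ 3 * l := by linarith
      calc _ ≤ (3 * l) * (x m / l) := mul_le_mul_of_nonneg_right h6 (by positivity)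
        _ = 3 * x m := by field_simp
    have h7 := mul_le_mul_of_nonneg_right h4 hM0
    have h8 := mul_le_mul_of_nonneg_right hBl hM0
    nlinarith
  have hsplit : ∀ v, l * x v = adj G v u + ∑ z, (if z = u then 0 else adj G v z * x z) := by
    intro v
    rw [← heig v, ← Finset.add_sum_erase _ _ (Finset.mem_univ u),
      ← Finset.add_sum_erase (a := u) _ (fun z => if z = u then 0 else adj G v z * x z)
        (Finset.mem_univ u), if_pos rfl, hu, mul_one, zero_add]
    congr 1
    exact Finset.sum_congr rfl fun z hz => (if_neg (by simpa using hz)).symm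
  have hM : (l / 2 + 1) * x m ≤ 1 := by
    have h1 := hsplit m
    have h2 := hT m hmu
    have h3 := adj_le_one G m u
    linarith
  rw [hsplit w, adj_eq_zero hwu, zero_add]
  refine (hT w hw).trans_lt ?_
  by_cases hm0 : x m = 0
  · rw [hm0]; norm_num
  · have : 0 < x m := lt_of_le_of_ne hM0 (Ne.symm hm0)
    linarith

end Estimates

/-- Attaching all other vertices to a vertex of maximum Perron weight does not decrease the spectral
radius. -/
theorem exists_dominating_vertex [DecidableEq V] (hG : CodegreeLeTwo G) (S : Finset V)
    (hcov : ∀ v w, G.Adj v w → v ∈ S ∨ w ∈ S) {l : ℝ} (hl : IsPerronValue G l) (hl0 : 100 ≤ l)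
    (hn : (Fintype.card V : ℝ) ≤ l ^ 2 + 1) (hS : 8 * (S.card : ℝ) ^ 2 ≤ l) :
    ∃ u, l ^ 2 - 5 / 2 * l - 2 ≤ degR G u ∧
      ∀ l', IsPerronValue (join (⊤ : SimpleGraph (Fin 1)) (linkGraph G u)) l' →
        l ≤ l' ∧ (l = l' → ∀ v, v ≠ u → G.Adj u v) := by
  classical
  obtain ⟨B, hBcard, hB⟩ := exists_exceptional_set hG S hcov
  have hBl : (B.card : ℝ) ≤ l / 4 := by
    have : (B.card : ℝ) ≤ 2 * (S.card : ℝ) ^ 2 := by exact_mod_cast hBcard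
    linarith
  obtain ⟨x, u, hx0, hx1, hu, heig⟩ := hl.exists_max_eq_one
  refine ⟨u, le_degR_max hx0 hx1 hu heig hB hG (by linarith) hn hBl, fun l' hl' => ?_⟩
  have hlt : ∀ w, w ≠ u → ¬ G.Adj u w → l * x w < 1 := fun w hw hwu =>
    mul_lt_one_of_not_adj hx0 hx1 hu heig hB hG hl0 hn hBl hw fun h => hwu h.symm
  -- The old eigenvector, carried over to the modified graph as a test vector; its norm is unchanged
  -- because `x u = 1`.
  let y : Fin 1 ⊕ {v // v ≠ u} → ℝ := Sum.elim (fun _ => 1) fun w => x w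
  have hsplit : ∀ f : V → ℝ, ∑ v, f v = f u + ∑ w : {v // v ≠ u}, f w :=
    fun f => Fintype.sum_eq_add_sum_subtype_ne f u
  have hsq : ∑ v, y v ^ 2 = ∑ v, x v ^ 2 := by
    rw [hsplit, Fintype.sum_sum_type]
    simp [y, hu]
  have hsqpos : 0 < ∑ v, y v ^ 2 := by
    rw [Fintype.sum_sum_type]
    have : 0 ≤ ∑ w : {v // v ≠ u}, y (Sum.inr w) ^ 2 := Finset.sum_nonneg fun _ _ => sq_nonneg _
    simp only [y, Finset.univ_unique, Sum.elim_inl, one_pow, Finset.sum_singleton] at this ⊢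
    linarith
  have heigu : ∀ w, adj G u w + ∑ z : {v // v ≠ u}, adj G w z * x z = l * x w := by
    intro w
    rw [← heig w, hsplit, hu, mul_one, adj_comm]
  have hjoin : quadForm (join (⊤ : SimpleGraph (Fin 1)) (linkGraph G u)) y =
      ∑ w : {v // v ≠ u}, (2 * x w + x w * ∑ z : {v // v ≠ u},
        adj G u w * adj G u z * adj G w z * x z) := by
    unfold quadForm
    simp only [Fintype.sum_sum_type, y, Sum.elim_inl, Sum.elim_inr, join_adj_inl, join_adj_inl_inr,
      join_adj_inr_inl, join_adj_inr, adj_linkGraph, Finset.univ_unique, Finset.sum_singleton]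
    rw [zero_mul, zero_add, one_mul, ← Finset.sum_add_distrib]
    exact Finset.sum_congr rfl fun w _ => by ring
  have hquad : l * ∑ v, x v ^ 2 = ∑ w : {v // v ≠ u}, (2 * (adj G u w * x w) +
      x w * ∑ z : {v // v ≠ u}, adj G w z * x z) := by
    have h1 : l * ∑ v, x v ^ 2 = ∑ v, x v * (l * x v) := by
      rw [Finset.mul_sum]
      exact Finset.sum_congr rfl fun v _ => by ring
    have h2 : l * x u = ∑ w : {v // v ≠ u}, adj G u w * x w := by
      rw [← heigu u, adj_eq_zero G.irrefl, zero_add]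
    rw [h1, hsplit, h2, hu, one_mul, ← Finset.sum_add_distrib]
    refine Finset.sum_congr rfl fun w _ => ?_
    rw [← heigu]
    ring
  have hle : l * ∑ v, y v ^ 2 ≤ quadForm (join (⊤ : SimpleGraph (Fin 1)) (linkGraph G u)) y := by
    rw [hsq, hquad, hjoin]
    have hsym : ∑ w : {v // v ≠ u}, x w * ∑ z : {v // v ≠ u}, (1 - adj G u z) * adj G w z * x z =
        ∑ w : {v // v ≠ u}, (1 - adj G u w) * x w * ∑ z : {v // v ≠ u}, adj G w z * x z := by
      simp only [Finset.mul_sum]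
      rw [Finset.sum_comm]
      refine Finset.sum_congr rfl fun w _ => Finset.sum_congr rfl fun z _ => ?_
      rw [adj_comm G z w]
      ring
    -- A lost edge has an end not adjacent to `u` and is charged to it: `1 ≤ αβ + (1 - α) + (1 - β)`
    -- for the indicators `α`, `β` of adjacency to `u`.
    have hterm : ∀ w : {v // v ≠ u}, x w * ∑ z : {v // v ≠ u}, adj G w z * x z ≤
        x w * (∑ z : {v // v ≠ u}, adj G u w * adj G u z * adj G w z * x z) +
        (x w * ∑ z : {v // v ≠ u}, (1 - adj G u z) * adj G w z * x z) +
        (1 - adj G u w) * x w * ∑ z : {v // v ≠ u}, adj G w z * x z := by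
      intro w
      have h1 : (1 - adj G u w) * x w * ∑ z : {v // v ≠ u}, adj G w z * x z =
          x w * ∑ z : {v // v ≠ u}, (1 - adj G u w) * (adj G w z * x z) := by
        rw [← Finset.mul_sum]
        ring
      rw [h1, ← mul_add, ← mul_add, ← Finset.sum_add_distrib, ← Finset.sum_add_distrib]
      refine mul_le_mul_of_nonneg_left (Finset.sum_le_sum fun z _ => ?_) (hx0 w)
      have h2 : 0 ≤ adj G w z * x z := mul_nonneg (adj_nonneg _ _ _) (hx0 z)
      have h3 : 0 ≤ (1 - adj G u w) * (1 - adj G u z) :=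
        mul_nonneg (by linarith [adj_le_one G u w]) (by linarith [adj_le_one G u z])
      nlinarith [mul_nonneg h2 h3]
    -- The loss charged to a non-neighbour `w` is `2 x w · (l x w)`, the gain from its new edge is
    -- `2 x w`, and `l x w < 1`.
    have hfin : ∀ w : {v // v ≠ u}, 2 * ((1 - adj G u w) * x w *
        ∑ z : {v // v ≠ u}, adj G w z * x z) ≤ 2 * ((1 - adj G u w) * x w) := by
      intro w
      by_cases h : G.Adj u w
      · rw [adj_eq_one h]
        simp
      · have h1 := heigu w
        rw [adj_eq_zero h, zero_add] at h1
        rw [h1]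
        have h2 := hlt w w.2 h
        rw [adj_eq_zero h]
        nlinarith [hx0 w]
    have hA := Finset.sum_le_sum fun (w : {v // v ≠ u}) (_ : w ∈ Finset.univ) => hterm w
    have hC := Finset.sum_le_sum fun (w : {v // v ≠ u}) (_ : w ∈ Finset.univ) => hfin w
    simp only [Finset.sum_add_distrib] at hA ⊢
    rw [hsym] at hA
    rw [← Finset.mul_sum] at hC
    have hD : ∑ w : {v // v ≠ u}, 2 * ((1 - adj G u w) * x w) =
        ∑ w : {v // v ≠ u}, 2 * x w - ∑ w : {v // v ≠ u}, 2 * (adj G u w * x w) := by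
      rw [← Finset.sum_sub_distrib]
      exact Finset.sum_congr rfl fun w _ => by ring
    linarith
  have hle' := hl'.quadForm_le y
  refine ⟨le_of_mul_le_mul_right (hle.trans hle') hsqpos, fun heq v hv => ?_⟩
  by_contra hadj
  subst heq
  -- In the case of equality `y` is an eigenvector of the join, where `v` is adjacent to the centre
  -- only; this gives `l x v = 1`.
  have h1 := hl'.eigen_of_eq y (le_antisymm hle' hle) (Sum.inr ⟨v, hv⟩)
  simp only [Fintype.sum_sum_type, y, Sum.elim_inl, Sum.elim_inr, join_adj_inr_inl, join_adj_inr,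
    adj_linkGraph, Finset.univ_unique, Finset.sum_singleton] at h1
  rw [adj_eq_zero hadj] at h1
  simp only [zero_mul, Finset.sum_const_zero, add_zero, mul_one] at h1
  exact (hlt v hv hadj).ne h1.symm

end Localization

/-! ### Assembling the extremal characterization -/

section Main

variable {V : Type*} {G : SimpleGraph V}

-- The ends of a maximum matching cover all edges.
open scoped Classical in
theorem exists_cover_of_not_hasMatching {t : ℕ} (h : ¬ HasMatching G (t + 1)) :
    ∃ S : Finset V, S.card ≤ 2 * t ∧ ∀ v w, G.Adj v w → v ∈ S ∨ w ∈ S := by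
  induction t with
  | zero =>
    refine ⟨∅, by simp, fun v w hvw => ?_⟩
    exact absurd (hasMatching_succ (f := fun i : Fin 0 => i.elim0) (fun i => i.elim0)
      (fun i => i.elim0) hvw (fun i => i.elim0) fun i => i.elim0) h
  | succ t ih =>
    by_cases ht : HasMatching G (t + 1)
    · obtain ⟨f, hf, hadj⟩ := ht
      refine ⟨Finset.univ.image fun p : Fin (t + 1) × Fin 2 => f p.1 p.2, ?_, fun v w hvw => ?_⟩
      · refine Finset.card_image_le.trans ?_
        simp
        omega
      · by_contra! hcon
        simp only [Finset.mem_image, Finset.mem_univ, true_and, not_exists, Prod.forall] at hcon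
        exact h (hasMatching_succ hf hadj hvw hcon.1 hcon.2)
    · obtain ⟨S, hS, hcov⟩ := ih ht
      exact ⟨S, by omega, hcov⟩

theorem HasMatching.map_iso {W : Type*} {H : SimpleGraph W} (e : G ≃g H) {k : ℕ}
    (h : HasMatching G k) : HasMatching H k := by
  obtain ⟨f, hf, hadj⟩ := h
  exact ⟨fun i j => e (f i j), fun i j i' j' h => hf _ _ _ _ (e.injective h),
    fun i => e.map_adj_iff.2 (hadj i)⟩

/-- A graph with a dominating vertex is the join of this vertex and its link. -/
noncomputable def linkGraphIso {u : V} (hu : ∀ v, v ≠ u → G.Adj u v) :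
    join (⊤ : SimpleGraph (Fin 1)) (linkGraph G u) ≃g G where
  toEquiv := Equiv.ofBijective
    (Sum.elim (fun _ => u) Subtype.val : Fin 1 ⊕ {v // v ≠ u} → V) (by
      constructor
      · rintro (a | a) (b | b) h
        · rw [Subsingleton.elim a b]
        · exact absurd h.symm b.2
        · exact absurd h a.2
        · exact congrArg Sum.inr (Subtype.ext h)
      · intro v
        by_cases hv : v = u
        · exact ⟨Sum.inl 0, hv.symm⟩
        · exact ⟨Sum.inr ⟨v, hv⟩, rfl⟩)
  map_rel_iff' := by
    rintro (a | a) (b | b)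
    · change G.Adj u u ↔ _
      simp [join, Subsingleton.elim a b]
    · change G.Adj u b ↔ _
      simpa [join] using hu b b.2
    · change G.Adj a u ↔ _
      simpa [join] using (hu a a.2).symm
    · change G.Adj a b ↔ _
      simp [join, linkGraph, hu a a.2, hu b b.2]

variable [Fintype V]

theorem iso_of_perron_le [DecidableEq V] {t b : ℕ} (ht : 1 ≤ t)
    (hcard : 2 * t + b = Fintype.card V) (hG : IsOuterplanar G)
    (hfree : ¬ HasMatching G (t + 1)) {l s : ℝ} (hl : IsPerronValue G l)
    (hs : IsPerronValue (join (⊤ : SimpleGraph (Fin 1))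
      (SimpleGraph.pathGraph (2 * t - 1) ⊕g (⊥ : SimpleGraph (Fin b)))) s)
    (hsl : s ≤ l) (hl0 : 100 ≤ l) (hlt : 32 * (t : ℝ) ^ 2 ≤ l) :
    Nonempty (G ≃g join (⊤ : SimpleGraph (Fin 1))
      (SimpleGraph.pathGraph (2 * t - 1) ⊕g (⊥ : SimpleGraph (Fin b)))) := by
  classical
  have ht1 : (1 : ℝ) ≤ t := by exact_mod_cast ht
  have hcod := hG.codegreeLeTwo
  obtain ⟨S, hS, hcov⟩ := exists_cover_of_not_hasMatching hfree
  have hn : (Fintype.card V : ℝ) ≤ l ^ 2 + 1 := by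
    have h1 := hs.join_lower.1
    have h2 : Fintype.card (Fin (2 * t - 1) ⊕ Fin b) + 1 = Fintype.card V := by
      simp
      omega
    have h3 : s ^ 2 ≤ l ^ 2 := by nlinarith [hs.nonneg]
    rw [← h2]
    push_cast
    linarith
  have hS' : 8 * (S.card : ℝ) ^ 2 ≤ l := by
    have h1 : (S.card : ℝ) ≤ 2 * t := by exact_mod_cast hS
    have h2 : (S.card : ℝ) ^ 2 ≤ (2 * t) ^ 2 := by gcongr
    nlinarith
  obtain ⟨u, hdeg, hu⟩ := exists_dominating_vertex hcod S hcov hl hl0 hn hS'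
  obtain ⟨l', hl'⟩ := exists_isPerronValue (join (⊤ : SimpleGraph (Fin 1)) (linkGraph G u))
  obtain ⟨hll', heq⟩ := hu l' hl'
  have hac : (linkGraph G u).IsAcyclic :=
    hG.isAcyclic (u := u) ⟨Subtype.val, fun h => h.1⟩ Subtype.val_injective (fun w => w.2)
      fun a b h => h.2.1
  have hdeg3 : ∀ v x y z, (linkGraph G u).Adj v x → (linkGraph G u).Adj v y →
      (linkGraph G u).Adj v z → x = y ∨ x = z ∨ y = z := by
    intro v x y z hx hy hz
    have := hcod u v x y z v.2.symm hx.2.2 hy.2.2 hz.2.2 hx.1.symm hy.1.symm hz.1.symm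
    simpa [Subtype.ext_iff] using this
  -- A matching of size `t` covers at most `2t` neighbours of `u`; the large degree of `u` leaves
  -- another one for the edge number `t + 1`.
  have hmat : ¬ HasMatching (linkGraph G u) t := by
    rintro ⟨f, hf, hadj⟩
    let T : Finset V := Finset.univ.image fun p : Fin t × Fin 2 => (f p.1 p.2 : V)
    have hT : T.card ≤ 2 * t := by
      refine Finset.card_image_le.trans ?_
      simp
      omega
    have hdegu : 2 * t < (G.neighborFinset u).card := by
      rw [degR_eq] at hdeg
      have : (2 * t : ℝ) < G.degree u := by nlinarith
      rw [SimpleGraph.card_neighborFinset_eq_degree]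
      exact_mod_cast this
    obtain ⟨w, hw, hwT⟩ := Finset.exists_mem_notMem_of_card_lt_card (hT.trans_lt hdegu)
    rw [SimpleGraph.mem_neighborFinset] at hw
    refine hfree (hasMatching_succ (f := fun i j => (f i j : V)) (fun i j i' j' h =>
      hf _ _ _ _ (Subtype.ext h)) (fun i => (hadj i).1) hw (fun i j => (f i j).2) fun i j h => ?_)
    exact hwT (Finset.mem_image.2 ⟨(i, j), Finset.mem_univ _, h⟩)
  have hcardW : 2 * t - 1 + b = Fintype.card {v // v ≠ u} := by
    have := Fintype.card_subtype_compl (fun v => v = u)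
    rw [Fintype.card_subtype_eq] at this
    simp only [ne_eq]
    omega
  obtain ⟨e⟩ := join_iso_of_le ht hcardW hac hdeg3 hmat hl' hs (hsl.trans hll')
    (by nlinarith)
  -- Now `s ≤ l ≤ l' = s`, and the equality case makes `u` dominating in `G` itself.
  have hls : l' = s := hl'.of_iso (joinIso e) hs
  have hall := heq (le_antisymm hll' (hls ▸ hsl))
  exact ⟨(linkGraphIso hall).symm.trans (joinIso e)⟩

theorem isOuterplanar_joinPath (n t : ℕ) : IsOuterplanar (joinPath n t) := by
  refine isOuterplanar_join (k := Sum.elim (fun i : Fin (2 * t - 1) => (i : ℕ))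
    fun j : Fin (n - 2 * t) => 2 * t - 1 + j) ?_ ?_
  · rintro (i | i) (j | j) h
    · exact congrArg Sum.inl (Fin.ext h)
    · simp only [Sum.elim_inl, Sum.elim_inr] at h
      omega
    · simp only [Sum.elim_inl, Sum.elim_inr] at h
      omega
    · simp only [Sum.elim_inr] at h
      exact congrArg Sum.inr (Fin.ext (by omega))
  · rintro (i | i) (j | j) h
    · simpa [SimpleGraph.pathGraph_adj] using h
    all_goals simp at h

open scoped Classical in
theorem not_hasMatching_joinPath {n t : ℕ} (ht : 1 ≤ t) : ¬ HasMatching (joinPath n t) (t + 1) := by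
  -- The centre and every second path vertex, namely the `t - 1` odd positions counted from `0`.
  let C : Finset (Fin 1 ⊕ (Fin (2 * t - 1) ⊕ Fin (n - 2 * t))) :=
    insert (Sum.inl 0) (Finset.univ.image fun j : Fin (t - 1) =>
      Sum.inr (Sum.inl ⟨2 * j + 1, by omega⟩))
  have hC : C.card < t + 1 := by
    have h1 := Finset.card_insert_le (Sum.inl 0 : Fin 1 ⊕ (Fin (2 * t - 1) ⊕ Fin (n - 2 * t)))
      (Finset.univ.image fun j : Fin (t - 1) => Sum.inr (Sum.inl ⟨2 * j + 1, by omega⟩))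
    have h2 : (Finset.univ.image fun j : Fin (t - 1) =>
        (Sum.inr (Sum.inl ⟨2 * j + 1, by omega⟩) :
          Fin 1 ⊕ (Fin (2 * t - 1) ⊕ Fin (n - 2 * t)))).card ≤ t - 1 :=
      Finset.card_image_le.trans (by simp)
    have h3 : C.card ≤ _ := h1
    omega
  have hodd : ∀ i : Fin (2 * t - 1), (i : ℕ) % 2 = 1 → (Sum.inr (Sum.inl i) : Fin 1 ⊕ _) ∈ C := by
    intro i hi
    refine Finset.mem_insert_of_mem (Finset.mem_image.2 ⟨⟨i / 2, by omega⟩, Finset.mem_univ _, ?_⟩)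
    congr 2
    ext
    simp only
    omega
  refine not_hasMatching_of_cover C hC ?_
  rintro (v | v) (w | w) h
  · rw [Subsingleton.elim v w] at h
    exact absurd h (SimpleGraph.irrefl _)
  · left
    rw [Subsingleton.elim v 0]
    exact Finset.mem_insert_self _ _
  · right
    rw [Subsingleton.elim w 0]
    exact Finset.mem_insert_self _ _
  · have hvw : (SimpleGraph.pathGraph (2 * t - 1) ⊕g (⊥ : SimpleGraph (Fin (n - 2 * t)))).Adj v w := by
      simpa [joinPath, join] using h
    rcases v with v | v <;> rcases w with w | w
    · have : (SimpleGraph.pathGraph (2 * t - 1)).Adj v w := by simpa using hvw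
      rw [SimpleGraph.pathGraph_adj] at this
      rcases Nat.mod_two_eq_zero_or_one (v : ℕ) with h0 | h0
      · right
        exact hodd w (by omega)
      · left
        exact hodd v h0
    all_goals simp at hvw

theorem mem_extremalOP_iff {t n : ℕ} (ht : 1 ≤ t) (hn : 2 * t ≤ n)
    (hn0 : (100 : ℝ) ^ 2 ≤ (n : ℝ) - 1) (hnt : (32 * (t : ℝ) ^ 2) ^ 2 ≤ (n : ℝ) - 1)
    (G : SimpleGraph (Fin n)) :
    G ∈ extremalOP n (copiesK2 (t + 1)) ↔ Nonempty (G ≃g joinPath n t) := by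
  have : Nonempty (Fin n) := ⟨⟨0, by omega⟩⟩
  obtain ⟨s, hs⟩ := exists_isPerronValue (joinPath n t)
  have hs2 : (n : ℝ) - 1 ≤ s ^ 2 := by
    have h1 := hs.join_lower.1
    have h2 : Fintype.card (Fin (2 * t - 1) ⊕ Fin (n - 2 * t)) + 1 = n := by
      simp
      omega
    have h3 : (n : ℝ) = Fintype.card (Fin (2 * t - 1) ⊕ Fin (n - 2 * t)) + 1 := by
      exact_mod_cast h2.symm
    linarith
  have hs100 : 100 ≤ s := le_of_sq_le_sq (by linarith) hs.nonneg
  have hst : 32 * (t : ℝ) ^ 2 ≤ s := le_of_sq_le_sq (by linarith) hs.nonneg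
  have hfree : ∀ G : SimpleGraph (Fin n), (copiesK2 (t + 1)).Free G ↔ ¬ HasMatching G (t + 1) :=
    fun G => not_congr (hasMatching_iff _).symm
  have hmem : ∀ G : SimpleGraph (Fin n), Nonempty (G ≃g joinPath n t) →
      G ∈ freeOuterplanar n (copiesK2 (t + 1)) ∧ rho G = ENNReal.ofReal s := by
    rintro G ⟨e⟩
    refine ⟨⟨(isOuterplanar_joinPath n t).of_iso e, (hfree G).2 fun h =>
      not_hasMatching_joinPath ht (h.map_iso e)⟩, ?_⟩
    obtain ⟨l, hl⟩ := exists_isPerronValue G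
    rw [hl.rho_eq, hl.of_iso e hs]
  have hmax : ∀ G ∈ freeOuterplanar n (copiesK2 (t + 1)), ENNReal.ofReal s ≤ rho G →
      Nonempty (G ≃g joinPath n t) := by
    rintro G ⟨hG, hGf⟩ hle
    obtain ⟨l, hl⟩ := exists_isPerronValue G
    rw [hl.rho_eq, ENNReal.ofReal_le_ofReal_iff hl.nonneg] at hle
    exact iso_of_perron_le ht (by simp; omega) hG ((hfree G).1 hGf) hl hs hle (hs100.trans hle)
      (hst.trans hle)
  -- A graph with larger spectral radius would be isomorphic to the candidate and so have spectral
  -- radius `s` after all.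
  have hspex : spexOP n (copiesK2 (t + 1)) = ENNReal.ofReal s := by
    apply le_antisymm
    · refine iSup₂_le fun G hG => ?_
      by_contra! hlt
      rw [(hmem G (hmax G hG hlt.le)).2] at hlt
      exact lt_irrefl _ hlt
    · have hc : Fintype.card (Fin n) =
          Fintype.card (Fin 1 ⊕ (Fin (2 * t - 1) ⊕ Fin (n - 2 * t))) := by
        simp
        omega
      have e : (joinPath n t).comap (Fintype.equivOfCardEq hc) ≃g joinPath n t :=
        SimpleGraph.Iso.comap (Fintype.equivOfCardEq hc) (joinPath n t)
      obtain ⟨h1, h2⟩ := hmem _ ⟨e⟩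
      rw [← h2]
      exact le_iSup₂ (f := fun (G : SimpleGraph (Fin n))
        (_ : G ∈ freeOuterplanar n (copiesK2 (t + 1))) => rho G) _ h1
  constructor
  · rintro ⟨hG, hrho⟩
    exact hmax G hG (by rw [hrho, hspex])
  · intro h
    obtain ⟨h1, h2⟩ := hmem G h
    exact ⟨h1, by rw [h2, hspex]⟩

theorem star_iso_joinPath {n : ℕ} (hn : 2 ≤ n) : Nonempty (star n ≃g joinPath n 1) := by
  have hc : Fintype.card (Fin (n - 1)) = Fintype.card (Fin (2 * 1 - 1) ⊕ Fin (n - 2 * 1)) := by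
    simp
    omega
  refine ⟨⟨Equiv.sumCongr (Equiv.refl _) (Fintype.equivOfCardEq hc), ?_⟩⟩
  have hnone : ∀ v w, ¬ (SimpleGraph.pathGraph (2 * 1 - 1) ⊕g
      (⊥ : SimpleGraph (Fin (n - 2 * 1)))).Adj v w := by
    rintro (v | v) (w | w)
    · rw [SimpleGraph.sum_adj_inl, SimpleGraph.pathGraph_adj]
      omega
    all_goals simp
  rintro (a | a) (b | b)
  · simp [star, joinPath, join, Subsingleton.elim a b]
  · simp [star, joinPath, join]
  · simp [star, joinPath, join]
  · have := hnone (Fintype.equivOfCardEq hc a) (Fintype.equivOfCardEq hc b)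
    simp only [star, joinPath, join, SimpleGraph.sup_adj, Equiv.sumCongr_apply, Sum.map_inr,
      SimpleGraph.sum_adj_inr, completeBipartiteGraph_adj, Sum.isLeft_inr, Sum.isRight_inr]
    simp only [this]
    simp

/-- The left side is `(32 t²)²`. From `t = 10` on, it grows by a factor of at most `4` per step, the
right side by exactly `4`. -/
theorem pow_four_le_two_pow {t : ℕ} (ht : 10 ≤ t) :
    1024 * (t : ℝ) ^ 4 ≤ 6.5025 * 2 ^ (2 * t + 1) := by
  induction t, ht using Nat.le_induction with
  | base => norm_num
  | succ t ht ih =>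
    have ht' : (10 : ℝ) ≤ t := by exact_mod_cast ht
    have h1 : ((t : ℝ) + 1) ^ 2 ≤ 2 * t ^ 2 := by nlinarith
    have h2 : ((t : ℝ) + 1) ^ 4 ≤ 4 * t ^ 4 := by
      calc ((t : ℝ) + 1) ^ 4 = (((t : ℝ) + 1) ^ 2) ^ 2 := by ring
        _ ≤ (2 * (t : ℝ) ^ 2) ^ 2 := by gcongr
        _ = 4 * t ^ 4 := by ring
    have h3 : (2 : ℝ) ^ (2 * (t + 1) + 1) = 4 * 2 ^ (2 * t + 1) := by ring
    rw [h3]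
    push_cast
    linarith

end Main

end OuterplanarSpex

theorem theorem3 (t n : ℕ) (ht : 1 ≤ t) (N : ℝ)
    (hN : N = max (1.27 * 10 ^ 7) (6.5025 * 2 ^ (2 * t + 1)))
    (hn : N + 3 / 2 + 3 * Real.sqrt (N - 7 / 4) ≤ (n : ℝ)) :
    (t = 1 → ∀ G : SimpleGraph (Fin n),
      G ∈ OuterplanarSpex.extremalOP n (OuterplanarSpex.copiesK2 (t + 1)) ↔
        Nonempty (G ≃g OuterplanarSpex.star n)) ∧
    (2 ≤ t → ∀ G : SimpleGraph (Fin n),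
      G ∈ OuterplanarSpex.extremalOP n (OuterplanarSpex.copiesK2 (t + 1)) ↔
        Nonempty (G ≃g OuterplanarSpex.joinPath n t)) := by
  have h1 : 1.27 * 10 ^ 7 ≤ N := hN ▸ le_max_left _ _
  have h2 : 6.5025 * 2 ^ (2 * t + 1) ≤ N := hN ▸ le_max_right _ _
  have h3 : N ≤ (n : ℝ) - 1 := by
    have := Real.sqrt_nonneg (N - 7 / 4)
    linarith
  have ht1 : (1 : ℝ) ≤ t := by exact_mod_cast ht
  -- Up to `t = 10` the first term of the maximum suffices, as `1024 · 10⁴ < 1.27 · 10⁷`.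
  have h4 : 1024 * (t : ℝ) ^ 4 ≤ N := by
    rcases le_total t 10 with h | h
    · have h' : (t : ℝ) ≤ 10 := by exact_mod_cast h
      have : (t : ℝ) ^ 4 ≤ 10 ^ 4 := by gcongr
      norm_num at h1 this
      linarith
    · exact (OuterplanarSpex.pow_four_le_two_pow h).trans h2
  have h5 : 2 * t ≤ n := by
    have h6 : (t : ℝ) ≤ t ^ 4 := le_self_pow₀ ht1 (by norm_num)
    have h7 : (2 * t : ℝ) ≤ n := by linarith
    exact_mod_cast h7
  have key : ∀ G : SimpleGraph (Fin n),
      G ∈ OuterplanarSpex.extremalOP n (OuterplanarSpex.copiesK2 (t + 1)) ↔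
        Nonempty (G ≃g OuterplanarSpex.joinPath n t) :=
    OuterplanarSpex.mem_extremalOP_iff ht h5 (by norm_num at h1 ⊢; linarith)
      (by ring_nf at h4 ⊢; linarith)
  refine ⟨?_, fun _ => key⟩
  rintro rfl G
  rw [key]
  obtain ⟨e⟩ := OuterplanarSpex.star_iso_joinPath (n := n) (by omega)
  exact ⟨fun ⟨f⟩ => ⟨f.trans e.symm⟩, fun ⟨f⟩ => ⟨f.trans e⟩⟩
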